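/- **Contextual noninterference for print-programs of the core language $\lambda^L$.** *Terms.* Fix sets of users $\mathrm{User}$, locations $\mathrm{Loc}$ and built-in function constants. Constants $c$ are booleans, strings, users, locations and built-in functions (boolean and string functions, and fields, i.e. functions returning locations). Values, expressions and statements are $$v ::= c \mid \lambda x.e,\qquad e ::= v \mid x \mid e\,e \mid \mathsf{if}\ e\ \mathsf{then}\ e\ \mathsf{else}\ e \mid \mathsf{get}\ e \mid \mathsf{bind}\ e\ e \mid {\downarrow} e,$$ $$s ::= \mathsf{let}\ x=e\ \mathsf{in}\ s \mid \mathsf{set}\ x\ y \mid \mathsf{print}\ x\ y .$$ A *print-program* is a statement $\mathsf{let}\ x_1=e_1\ \mathsf{in}\ \dots\ \mathsf{print}\ u\ y$ (zero or more lets). *Stores and execution.* A store $\sigma$ assigns a value $\sigma[l]$ to each location and a finite list of values $\sigma[a]$ (the output channel) to each user $a$. Expressions evaluate in a fixed store by $(\lambda x.e)\,v \to [x\mapsto v]e$; $f\,c\to d$ if the built-in function $f$ maps $c$ to $d$; $\mathsf{get}\ l\to\sigma[l]$; $\mathsf{if}\ \mathsf{true}/\mathsf{false}\ \mathsf{then}\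 e_1\ \mathsf{else}\ e_2\to e_1/e_2$; $\mathsf{bind}\ v\ (\lambda x.e)\to[x\mapsto v]e$; ${\downarrow}e\to e$; inside the evaluation contexts $C ::= \bullet\mid C\,e\mid v\,C\mid\lambda x.C\mid\mathsf{get}\ C\mid\mathsf{if}\ C\ \mathsf{then}\ e_1\ \mathsf{else}\ e_2\mid\mathsf{if}\ v\ \mathsf{then}\ C\ \mathsf{else}\ e_2\mid\mathsf{if}\ v\ \mathsf{then}\ v_1\ \mathsf{else}\ C\mid\mathsf{bind}\ C\ e\mid\mathsf{bind}\ v\ C$. The statement $\mathsf{let}\ x=e\ \mathsf{in}\ s$ continues as $[x\mapsto v]s$ whenever $\sigma,e\to^* v$; $\mathsf{set}\ l\ v$ ends in $\sigma[l:=v]$; $\mathsf{print}\ a\ v$, for a user $a$, ends in the store that appends $v$ to $\sigma[a]$. Write $\sigma,s\to^*\sigma'$ for complete executions. *Types.* $B ::= \mathsf{Bool}\mid\mathsf{Str}\mid\mathsf{User}\mid\langle T\rangle^\pi\mid\mathsf{Ref}\ T$ and $T ::= \{B\mid r\}\mid x{:}T\to T'$, with $B$ short for $\{B\mid\top\}$.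 A refinement $r$ is any predicate of the program variables in scope, the location part of the current store (the logical variable $\sigma$), and the value variable $\nu$. A policy $\pi=\lambda(s,u).p$ is any predicate of the program variables in scope, $\sigma$, the location part $s$ of a store, and a user $u$. An environment $\Gamma$ is a list of bindings $x:T$ and path conditions. $\Gamma\vDash p$ means that $p$ holds under all interpretations (of $\sigma$, the variables, and the other free parameters of $p$) that respect sorts (tags do not change the sort of a value) and satisfy the path conditions in $\Gamma$ and the refinement of every variable in $\Gamma$ whose type is of the form $\{B\mid r\}$. *Policy module.* Each constant $c$ has a type $\mathrm{ty}(c)$: for booleans, strings and users it is $\{B\mid\nu=c\}$ with the evident $B$; for a location $l$ it is $\{\mathsf{Ref}\ T_l\mid\nu=l\}$ with a declared type $T_l$; for a built-in function $f$ it is a declared type $x{:}\{B\mid r\}\to T$ with $B\in\{\mathsf{Bool},\mathsf{Str},\mathsf{User}\}$. The declared types are closed: they mention neither program variables nor $\sigma$. For every constant $c$ of sort $B$ satisfying $r$, $f$ is defined at $c$ and its value $d$ satisfies $\epsilon\vdash\mathrm{ty}(d)<:T[x\mapsto c]$. *Subtyping.* $\Gamma\vdash B<:B$. If $\Gamma\vdash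 B<:B'$ and $\Gamma\vDash r\Rightarrow r'$, then $\Gamma\vdash\{B|r\}<:\{B'|r'\}$. If $\Gamma\vdash T_x'<:T_x$ and $\Gamma,x{:}T_x'\vdash T<:T'$, then $\Gamma\vdash (x{:}T_x\to T)<:(x{:}T_x'\to T')$. $\Gamma\vdash T<:\langle T\rangle^{\lambda.\top}$. If $\Gamma\vdash T<:T'$ and $\Gamma\vDash p'\Rightarrow p$ (for all $s,u$), then $\Gamma\vdash\langle T\rangle^{\lambda(s,u).p}<:\langle T'\rangle^{\lambda(s,u).p'}$. *Expression typing* $\Gamma;\sigma\vdash e::T$, with $\sigma$ symbolic: * $c::\mathrm{ty}(c)$; $x::T$ if $x{:}T\in\Gamma$; $\lambda x.e::x{:}T_x\to T$ if $\Gamma,x{:}T_x;\sigma\vdash e::T$; and subsumption. * If $e_1::x{:}T_x\to T$ and $e_2::T_x$, then $e_1\,e_2::T[x\mapsto e_2]$, provided that $x$ does not occur in $T$ or $e_2$ is a refinement term (a variable, a constant, or a constant applied to refinement terms). * If $t::\mathsf{Ref}\ \{B\mid r\}$ and $t$ is a refinement term, then $\mathsf{get}\ t::\{B\mid r\wedge\nu=\sigma[t]\}$.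 If here $B=\langle\{B'\mid r'\}\rangle^\pi$, then also $\mathsf{get}\ t::\{\langle\{B'\mid r'\wedge\nu=\sigma[t]\}\rangle^\pi\mid r\wedge\nu=\sigma[t]\}$. * If $e::\{\mathsf{Bool}\mid r\}$, $\Gamma,[\nu\mapsto\top]r;\sigma\vdash e_1::T$ and $\Gamma,[\nu\mapsto\bot]r;\sigma\vdash e_2::T$, then $\mathsf{if}\ e\ \mathsf{then}\ e_1\ \mathsf{else}\ e_2::T$. * If $e_1::\langle T_1\rangle^\pi$ and $e_2::T_1\to\langle T_2\rangle^\pi$ (non-dependent), then $\mathsf{bind}\ e_1\ e_2::\langle T_2\rangle^\pi$. * If $e::\langle\{\mathsf{Bool}\mid\nu\Rightarrow r\}\rangle^{\lambda(s,u).\pi[(s,u)]\wedge r}$, where $r$ does not mention $\nu,s,u$, then ${\downarrow}e::\langle\{\mathsf{Bool}\mid\nu\Rightarrow r\}\rangle^{\pi}$. *Statement typing* $\Gamma;\sigma\vdash s$: $\mathsf{let}\ x=e\ \mathsf{in}\ s$ is well-typed if $\Gamma;\sigma\vdash e::T$ and $\Gamma,x{:}T;\sigma\vdash s$ for some $T$;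 $\mathsf{print}\ x\ y$ is well-typed if $x::\langle\{\mathsf{User}\mid\pi[(\sigma,\nu)]\}\rangle^\pi$ and $y::\langle\mathsf{Str}\rangle^\pi$ for some $\pi$; $\mathsf{set}\ x\ y$ is well-typed if $x::\mathsf{Ref}\ T$ and $y::T$ for some $T$. *Observational equivalence.* Let $\pi_l=\pi$ if $T_l=\{\langle T\rangle^\pi\mid r\}$, and $\pi_l=\lambda.\top$ for all other forms of $T_l$. For a user $o$, the set $\mathrm{obs}_o(\sigma_1,\sigma_2)$ consists of the locations $l$ with $\pi_l[(\sigma_1,o)]\vee\pi_l[(\sigma_2,o)]$. Write $\sigma_1\sim_o\sigma_2$ if $\sigma_1[o]=\sigma_2[o]$ and $\sigma_1[l]=\sigma_2[l]$ for all $l\in\mathrm{obs}_o(\sigma_1,\sigma_2)$. **Lemma.** Let $o$ be a user, and let $\sigma_1\sim_o\sigma_2$ be stores that are well-typed, i.e. $\epsilon\vdash\sigma_j[l]::T_l$ for every location $l$ and $j\in\{1,2\}$. Let $s$ be a print-program with $\epsilon;\sigma\vdash s$. If $\sigma_j,s\to^*\sigma_j'$ for $j\in\{1,2\}$, then $\sigma_1'\sim_o\sigma_2'$.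 -/

import Mathlib

universe u

/-- The parameters of the language: users, store locations, and built-in function constants
(boolean and string functions, and fields, i.e. functions that return locations). -/
structure Sig where
  User : Type u
  Loc : Type u
  Fn : Type u

/-- Constants `c`. -/
inductive Const (S : Sig.{u}) : Type u
  | bool (b : Bool)
  | str (w : String)
  | user (a : S.User)
  | loc (l : S.Loc)
  | fn (f : S.Fn)

/-- Expressions `e`, with de Bruijn indices for program variables. -/
inductive Expr (S : Sig.{u}) : Type u
  | const (c : Const S)
  | lam (e : Expr S)
  | var (i : ℕ)
  | app (e₁ e₂ : Expr S)
  | ite (e e₁ e₂ : Expr S)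
  | get (e : Expr S)
  | bind (e₁ e₂ : Expr S)
  | down (e : Expr S)

/-- Values `v ::= c | λx. e`. -/
inductive Val (S : Sig.{u}) : Type u
  | const (c : Const S)
  | lam (e : Expr S)

/-- A value, seen as an expression. -/
def Val.toExpr {S : Sig.{u}} : Val S → Expr S
  | .const c => .const c
  | .lam e => .lam e

/-- Statements, in the version of the language where a program ends in a single `set` or
`print`. -/
inductive Stmt (S : Sig.{u}) : Type u
  | letIn (e : Expr S) (s : Stmt S)
  | set (x y : Expr S)
  | print (x y : Expr S)

/-- The print-programs `let x₁ = e₁ in … print u y`. -/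
inductive Stmt.IsPrintProgram {S : Sig.{u}} : Stmt S → Prop
  | print (x y : Expr S) : IsPrintProgram (.print x y)
  | letIn (e : Expr S) {s : Stmt S} : IsPrintProgram s → IsPrintProgram (.letIn e s)

/-! ### Substitution -/

/-- Extend a renaming under a binder. -/
def liftRen (ξ : ℕ → ℕ) : ℕ → ℕ
  | 0 => 0
  | i + 1 => ξ i + 1

namespace Expr

/-- Renaming of free variables. -/
def rename {S : Sig.{u}} : (ℕ → ℕ) → Expr S → Expr S
  | _, const c => const c
  | ξ, lam e => lam (rename (liftRen ξ) e)
  | ξ, var i => var (ξ i)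
  | ξ, app e₁ e₂ => app (rename ξ e₁) (rename ξ e₂)
  | ξ, ite e e₁ e₂ => ite (rename ξ e) (rename ξ e₁) (rename ξ e₂)
  | ξ, get e => get (rename ξ e)
  | ξ, bind e₁ e₂ => bind (rename ξ e₁) (rename ξ e₂)
  | ξ, down e => down (rename ξ e)

/-- Extend a substitution under a binder. -/
def liftSub {S : Sig.{u}} (θ : ℕ → Expr S) : ℕ → Expr S
  | 0 => var 0
  | i + 1 => rename Nat.succ (θ i)

/-- Simultaneous capture-avoiding substitution. -/
def subst {S : Sig.{u}} : (ℕ → Expr S) → Expr S → Expr S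
  | _, const c => const c
  | θ, lam e => lam (subst (liftSub θ) e)
  | θ, var i => θ i
  | θ, app e₁ e₂ => app (subst θ e₁) (subst θ e₂)
  | θ, ite e e₁ e₂ => ite (subst θ e) (subst θ e₁) (subst θ e₂)
  | θ, get e => get (subst θ e)
  | θ, bind e₁ e₂ => bind (subst θ e₁) (subst θ e₂)
  | θ, down e => down (subst θ e)

/-- The substitution `[x ↦ a]` for the variable with index `0`. -/
def single {S : Sig.{u}} (a : Expr S) : ℕ → Expr S
  | 0 => a
  | i + 1 => var i

/-- `e.inst v` is `[x ↦ v] e`, where `x` is the variable with index `0`. -/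
def inst {S : Sig.{u}} (e : Expr S) (v : Val S) : Expr S :=
  e.subst (single v.toExpr)

end Expr

/-- Simultaneous capture-avoiding substitution in statements. -/
def Stmt.subst {S : Sig.{u}} : (ℕ → Expr S) → Stmt S → Stmt S
  | θ, .letIn e s => .letIn (e.subst θ) (Stmt.subst (Expr.liftSub θ) s)
  | θ, .set x y => .set (x.subst θ) (y.subst θ)
  | θ, .print x y => .print (x.subst θ) (y.subst θ)

/-- `s.inst v` is `[x ↦ v] s`, where `x` is the variable with index `0`. -/
def Stmt.inst {S : Sig.{u}} (s : Stmt S) (v : Val S) : Stmt S :=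
  s.subst (Expr.single v.toExpr)

/-! ### Stores -/

/-- The part of the store that maps locations to values. This is what refinements and policies
can talk about. -/
abbrev Mem (S : Sig.{u}) : Type u := S.Loc → Val S

/-- Stores: memory, and the output channel of every user. -/
structure Store (S : Sig.{u}) : Type u where
  mem : Mem S
  out : S.User → List (Val S)

open Classical in
/-- `σ[l := v]` -/
noncomputable def Store.write {S : Sig.{u}} (σ : Store S) (l : S.Loc) (v : Val S) : Store S where
  mem := Function.update σ.mem l v
  out := σ.out

open Classical in
/-- `σ[a += v]` -/
noncomputable def Store.emit {S : Sig.{u}} (σ : Store S) (a : S.User) (v : Val S) : Store S where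
  mem := σ.mem
  out := Function.update σ.out a (σ.out a ++ [v])

/-! ### Types

Refinement and policy predicates are represented by their meaning: a refinement over the program
variables in scope, the current store `σ` and the value variable `ν` is an arbitrary predicate of
an interpretation of these. Every refinement logic embeds into this one. -/

/-- An interpretation of the logical variable `σ` (the current store) and of the program
variables. -/
structure Interp (S : Sig.{u}) : Type u where
  mem : Mem S
  env : ℕ → Val S

/-- Interpret the innermost variable as `v`. -/
def Interp.push {S : Sig.{u}} (v : Val S) (I : Interp S) : Interp S where
  mem := I.mem
  env := fun i => match i with
    | 0 => v
    | j + 1 => I.env j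

/-- Forget the innermost variable. -/
def Interp.pop {S : Sig.{u}} (I : Interp S) : Interp S where
  mem := I.mem
  env := fun i => I.env (i + 1)

/-- Refinements without value variable, such as path conditions. -/
abbrev Cond (S : Sig.{u}) : Type u := Interp S → Prop

/-- Refinements; the second argument is the value variable `ν`. -/
abbrev Refn (S : Sig.{u}) : Type u := Interp S → Val S → Prop

/-- Policy predicates `λ (s, u). r`; the last two arguments are `s` and `u`. -/
abbrev Policy (S : Sig.{u}) : Type u := Interp S → Mem S → S.User → Prop

/-- The trivial refinement `⊤`. -/
def Refn.top {S : Sig.{u}} : Refn S := fun _ _ => True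

/-- The public policy `λ. ⊤`. -/
def Policy.top {S : Sig.{u}} : Policy S := fun _ _ _ => True

mutual

/-- Base types `B`: `Bool`, `Str`, `User`, tagged types `⟨T⟩^π`, references `Ref T`. -/
inductive BTy (S : Sig.{u}) : Type u
  | bool
  | str
  | user
  | tag (T : Ty S) (π : Interp S → (S.Loc → Val S) → S.User → Prop)
  | ref (T : Ty S)

/-- Types: refined base types `{B | r}` and dependent functions `x : Tx → T`, where `x` is the
innermost variable of `T`. -/
inductive Ty (S : Sig.{u}) : Type u
  | sc (B : BTy S) (r : Interp S → Val S → Prop)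
  | fn (Tx T : Ty S)

end

/-- `⟨T⟩^π` as a type, i.e. `{⟨T⟩^π | ⊤}`. -/
def Ty.tagged {S : Sig.{u}} (T : Ty S) (π : Policy S) : Ty S := .sc (.tag T π) Refn.top

/-- `Ref T` as a type. -/
def Ty.reft {S : Sig.{u}} (T : Ty S) : Ty S := .sc (.ref T) Refn.top

/-- Extend a transformation of interpretations under a binder. -/
def liftMap {S : Sig.{u}} (f : Interp S → Interp S) : Interp S → Interp S :=
  fun I => (f I.pop).push (I.env 0)

mutual

/-- Precompose all predicates of a base type with a transformation of interpretations. -/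
def BTy.map {S : Sig.{u}} : (Interp S → Interp S) → BTy S → BTy S
  | _, .bool => .bool
  | _, .str => .str
  | _, .user => .user
  | f, .tag T π => .tag (Ty.map f T) (fun I => π (f I))
  | f, .ref T => .ref (Ty.map f T)

/-- Precompose all predicates of a type with a transformation of interpretations. -/
def Ty.map {S : Sig.{u}} : (Interp S → Interp S) → Ty S → Ty S
  | f, .sc B r => .sc (BTy.map f B) (fun I => r (f I))
  | f, .fn Tx T => .fn (Ty.map f Tx) (Ty.map (liftMap f) T)

end

/-- A type, moved into the scope of one more variable. -/
def Ty.weaken {S : Sig.{u}} (T : Ty S) : Ty S := T.map Interp.pop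

/-- `T[x ↦ t]`, where `x` is the innermost variable of `T`, and `t` gives the meaning of a
refinement term. -/
def Ty.subst {S : Sig.{u}} (T : Ty S) (t : Interp S → Val S) : Ty S :=
  T.map fun I => I.push (t I)

/-- The type mentions neither program variables nor the current store `σ`. (Policies in it still
have their own parameters `s` and `u`.) -/
def Ty.Closed {S : Sig.{u}} (T : Ty S) : Prop := ∀ f : Interp S → Interp S, T.map f = T

mutual

/-- Values of the sort that underlies a base type. Tags are ignored. -/
def BTy.HasSort {S : Sig.{u}} : BTy S → Val S → Prop
  | .bool, v => ∃ b, v = .const (.bool b)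
  | .str, v => ∃ w, v = .const (.str w)
  | .user, v => ∃ a, v = .const (.user a)
  | .tag T _, v => Ty.HasSort T v
  | .ref _, v => ∃ l, v = .const (.loc l)

/-- Values of the sort that underlies a type. -/
def Ty.HasSort {S : Sig.{u}} : Ty S → Val S → Prop
  | .sc B _, v => BTy.HasSort B v
  | .fn _ _, v => (∃ e, v = .lam e) ∨ ∃ f, v = .const (.fn f)

end

/-- The primitive types. -/
inductive BTy.IsPrim {S : Sig.{u}} : BTy S → Prop
  | bool : IsPrim .bool
  | str : IsPrim .str
  | user : IsPrim .user

/-- What the logic knows about a variable of the given type: its sort and its refinement. -/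
def Ty.Holds {S : Sig.{u}} : Ty S → Interp S → Val S → Prop
  | .sc B r, I, v => B.HasSort v ∧ r I v
  | .fn Tx T, _, v => (Ty.fn Tx T).HasSort v

/-- The policy of a type. -/
def Ty.pol {S : Sig.{u}} : Ty S → Policy S
  | .sc (.tag _ π) _ => π
  | _ => Policy.top

/-! ### Constants and policy modules -/

/-- A policy module: the content type `T` of every location `l` (so `ty(l) = Ref T`), and the
types and meanings of the built-in functions and fields. -/
structure PolicyModule (S : Sig.{u}) : Type u where
  locTy : S.Loc → Ty S
  fnTy : S.Fn → Ty S
  delta : S.Fn → Const S → Option (Const S)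

/-- `ty(c)` -/
def PolicyModule.ty {S : Sig.{u}} (M : PolicyModule S) : Const S → Ty S
  | .bool b => .sc .bool fun _ v => v = .const (.bool b)
  | .str w => .sc .str fun _ v => v = .const (.str w)
  | .user a => .sc .user fun _ v => v = .const (.user a)
  | .loc l => .sc (.ref (M.locTy l)) fun _ v => v = .const (.loc l)
  | .fn f => M.fnTy f

/-! ### Dynamic semantics -/

/-- Expression evaluation `σ, e ⟶ e'`: the computation rules, and one rule for every form of
evaluation context. -/
inductive Step {S : Sig.{u}} (M : PolicyModule S) (σ : Mem S) : Expr S → Expr S → Prop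
  | beta (e : Expr S) (v : Val S) : Step M σ (.app (.lam e) v.toExpr) (e.inst v)
  | delta {f : S.Fn} {c d : Const S} : M.delta f c = some d →
      Step M σ (.app (.const (.fn f)) (.const c)) (.const d)
  | get (l : S.Loc) : Step M σ (.get (.const (.loc l))) (σ l).toExpr
  | iteTrue (e₁ e₂ : Expr S) : Step M σ (.ite (.const (.bool true)) e₁ e₂) e₁
  | iteFalse (e₁ e₂ : Expr S) : Step M σ (.ite (.const (.bool false)) e₁ e₂) e₂
  | bind (v : Val S) (e : Expr S) : Step M σ (.bind v.toExpr (.lam e)) (e.inst v)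
  | down (e : Expr S) : Step M σ (.down e) e
  | appL {e e' : Expr S} (e₂ : Expr S) : Step M σ e e' → Step M σ (.app e e₂) (.app e' e₂)
  | appR (v : Val S) {e e' : Expr S} : Step M σ e e' →
      Step M σ (.app v.toExpr e) (.app v.toExpr e')
  | lam {e e' : Expr S} : Step M σ e e' → Step M σ (.lam e) (.lam e')
  | getC {e e' : Expr S} : Step M σ e e' → Step M σ (.get e) (.get e')
  | iteC {e e' : Expr S} (e₁ e₂ : Expr S) : Step M σ e e' →
      Step M σ (.ite e e₁ e₂) (.ite e' e₁ e₂)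
  | iteThen (v : Val S) {e e' : Expr S} (e₂ : Expr S) : Step M σ e e' →
      Step M σ (.ite v.toExpr e e₂) (.ite v.toExpr e' e₂)
  | iteElse (v v₁ : Val S) {e e' : Expr S} : Step M σ e e' →
      Step M σ (.ite v.toExpr v₁.toExpr e) (.ite v.toExpr v₁.toExpr e')
  | bindL {e e' : Expr S} (e₂ : Expr S) : Step M σ e e' → Step M σ (.bind e e₂) (.bind e' e₂)
  | bindR (v : Val S) {e e' : Expr S} : Step M σ e e' →
      Step M σ (.bind v.toExpr e) (.bind v.toExpr e')

/-- Complete statement execution `σ, s ⟶* σ'`. -/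
inductive Exec {S : Sig.{u}} (M : PolicyModule S) : Store S → Stmt S → Store S → Prop
  | letIn {σ σ' : Store S} {e : Expr S} {v : Val S} {s : Stmt S} :
      Relation.ReflTransGen (Step M σ.mem) e v.toExpr → Exec M σ (s.inst v) σ' →
      Exec M σ (.letIn e s) σ'
  | set (σ : Store S) (l : S.Loc) (v : Val S) :
      Exec M σ (.set (.const (.loc l)) v.toExpr) (σ.write l v)
  | print (σ : Store S) (a : S.User) (v : Val S) :
      Exec M σ (.print (.const (.user a)) v.toExpr) (σ.emit a v)

/-! ### Typing environments and the logic -/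

/-- Entries of typing environments: `x : T`, or a path condition. -/
inductive Entry (S : Sig.{u}) : Type u
  | bind (T : Ty S)
  | cond (p : Cond S)

/-- Typing environments, innermost entry first. -/
abbrev TEnv (S : Sig.{u}) : Type u := List (Entry S)

/-- `x : T ∈ Γ`, with `T` moved into the scope of `Γ`. -/
inductive Lookup {S : Sig.{u}} : TEnv S → ℕ → Ty S → Prop
  | here (Γ : TEnv S) (T : Ty S) : Lookup (.bind T :: Γ) 0 T.weaken
  | there {Γ : TEnv S} {i : ℕ} {T : Ty S} (T' : Ty S) : Lookup Γ i T →
      Lookup (.bind T' :: Γ) (i + 1) T.weaken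
  | skip {Γ : TEnv S} {i : ℕ} {T : Ty S} (p : Cond S) : Lookup Γ i T →
      Lookup (.cond p :: Γ) i T

/-- A memory all of whose locations hold values of the declared sort. -/
def PolicyModule.Sorted {S : Sig.{u}} (M : PolicyModule S) (σ : Mem S) : Prop :=
  ∀ l, (M.locTy l).HasSort (σ l)

/-- The interpretations that satisfy the assumptions stored in an environment. -/
def PolicyModule.Sat {S : Sig.{u}} (M : PolicyModule S) : TEnv S → Interp S → Prop
  | [], I => M.Sorted I.mem
  | .bind T :: Γ, I => M.Sat Γ I.pop ∧ T.Holds I.pop (I.env 0)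
  | .cond p :: Γ, I => M.Sat Γ I ∧ p I

/-- Applications whose head is a constant. -/
inductive Expr.ConstHead {S : Sig.{u}} : Expr S → Prop
  | const (c : Const S) : ConstHead (.const c)
  | app {e₁ : Expr S} (e₂ : Expr S) : ConstHead e₁ → ConstHead (.app e₁ e₂)

/-- The meaning of an application of a constant to a constant in the logic. -/
def PolicyModule.applyConst {S : Sig.{u}} (M : PolicyModule S) : Val S → Val S → Val S
  | .const (.fn f), .const c => .const ((M.delta f c).getD c)
  | _, v => v

/-- `M.Reflects e t`: the program expression `e` is also a refinement term (a variable, a constant,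
or a constant applied to such terms), and `t` is its meaning. -/
inductive PolicyModule.Reflects {S : Sig.{u}} (M : PolicyModule S) :
    Expr S → (Interp S → Val S) → Prop
  | var (i : ℕ) : Reflects M (.var i) fun I => I.env i
  | const (c : Const S) : Reflects M (.const c) fun _ => .const c
  | app {e₁ e₂ : Expr S} {t₁ t₂ : Interp S → Val S} : e₁.ConstHead → Reflects M e₁ t₁ →
      Reflects M e₂ t₂ → Reflects M (.app e₁ e₂) fun I => M.applyConst (t₁ I) (t₂ I)

/-! ### Static semantics -/

mutual

/-- Subtyping of base types, `Γ ⊢ B <: B'`. -/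
inductive SubtyB {S : Sig.{u}} (M : PolicyModule S) : TEnv S → BTy S → BTy S → Prop
  | refl (Γ : TEnv S) (B : BTy S) : SubtyB M Γ B B
  | tag {Γ : TEnv S} {T T' : Ty S} {π π' : Policy S} : Subty M Γ T T' →
      (∀ I, M.Sat Γ I → ∀ s a, M.Sorted s → π' I s a → π I s a) →
      SubtyB M Γ (.tag T π) (.tag T' π')

/-- Subtyping, `Γ ⊢ T <: T'`. -/
inductive Subty {S : Sig.{u}} (M : PolicyModule S) : TEnv S → Ty S → Ty S → Prop
  | sc {Γ : TEnv S} {B B' : BTy S} {r r' : Refn S} : SubtyB M Γ B B' →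
      (∀ I, M.Sat Γ I → ∀ v, B.HasSort v → r I v → r' I v) →
      Subty M Γ (.sc B r) (.sc B' r')
  | fn {Γ : TEnv S} {Tx Tx' T T' : Ty S} : Subty M Γ Tx' Tx → Subty M (.bind Tx' :: Γ) T T' →
      Subty M Γ (.fn Tx T) (.fn Tx' T')
  | tagTop (Γ : TEnv S) (T : Ty S) : Subty M Γ T (T.tagged Policy.top)

end

/-- The refinement `r ∧ ν = σ[t]`. -/
def Refn.selects {S : Sig.{u}} (r : Refn S) (t : Interp S → Val S) : Refn S :=
  fun I v => r I v ∧ ∃ l, t I = .const (.loc l) ∧ v = I.mem l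

/-- The type `{Bool | ν ⇒ r}`. -/
def Ty.boolImp {S : Sig.{u}} (r : Cond S) : Ty S :=
  .sc .bool fun I v => v = .const (.bool true) → r I

/-- The type `{User | π[(σ, ν)]}`. -/
def Ty.viewer {S : Sig.{u}} (π : Policy S) : Ty S :=
  .sc .user fun I v => ∃ a, v = .const (.user a) ∧ π I I.mem a

/-- Expression typing, `Γ; σ ⊢ e :: T`. The logical variable `σ` is implicit: the predicates in
types take its value from the interpretation. -/
inductive HasTy {S : Sig.{u}} (M : PolicyModule S) : TEnv S → Expr S → Ty S → Prop
  | const (Γ : TEnv S) (c : Const S) : HasTy M Γ (.const c) (M.ty c)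
  | var {Γ : TEnv S} {i : ℕ} {T : Ty S} : Lookup Γ i T → HasTy M Γ (.var i) T
  | lam {Γ : TEnv S} {e : Expr S} {Tx T : Ty S} : HasTy M (.bind Tx :: Γ) e T →
      HasTy M Γ (.lam e) (.fn Tx T)
  /-- Application; the result type depends on the argument, which must be a refinement term. -/
  | app {Γ : TEnv S} {e₁ e₂ : Expr S} {Tx T : Ty S} {t : Interp S → Val S} :
      HasTy M Γ e₁ (.fn Tx T) → HasTy M Γ e₂ Tx → M.Reflects e₂ t →
      HasTy M Γ (.app e₁ e₂) (T.subst t)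
  /-- Application; the result type does not depend on the argument, which is arbitrary. -/
  | appConst {Γ : TEnv S} {e₁ e₂ : Expr S} {Tx T : Ty S} :
      HasTy M Γ e₁ (.fn Tx T.weaken) → HasTy M Γ e₂ Tx → HasTy M Γ (.app e₁ e₂) T
  | get {Γ : TEnv S} {x : Expr S} {B : BTy S} {r : Refn S} {t : Interp S → Val S} :
      HasTy M Γ x (Ty.reft (.sc B r)) → M.Reflects x t →
      HasTy M Γ (.get x) (.sc B (r.selects t))
  /-- The equation `ν = σ[x]` is also known of the content of a tagged value that is read. -/
  | getTag {Γ : TEnv S} {x : Expr S} {B : BTy S} {r r' : Refn S} {π : Policy S}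
      {t : Interp S → Val S} :
      HasTy M Γ x (Ty.reft (.sc (.tag (.sc B r) π) r')) → M.Reflects x t →
      HasTy M Γ (.get x) (.sc (.tag (.sc B (r.selects t)) π) (r'.selects t))
  | ite {Γ : TEnv S} {e e₁ e₂ : Expr S} {r : Refn S} {T : Ty S} :
      HasTy M Γ e (.sc .bool r) →
      HasTy M (.cond (fun I => r I (.const (.bool true))) :: Γ) e₁ T →
      HasTy M (.cond (fun I => r I (.const (.bool false))) :: Γ) e₂ T →
      HasTy M Γ (.ite e e₁ e₂) T
  | bind {Γ : TEnv S} {e₁ e₂ : Expr S} {T₁ T₂ : Ty S} {π : Policy S} :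
      HasTy M Γ e₁ (T₁.tagged π) → HasTy M Γ e₂ (.fn T₁ (T₂.tagged π).weaken) →
      HasTy M Γ (.bind e₁ e₂) (T₂.tagged π)
  | down {Γ : TEnv S} {e : Expr S} {r : Cond S} {π : Policy S} :
      HasTy M Γ e ((Ty.boolImp r).tagged fun I s a => π I s a ∧ r I) →
      HasTy M Γ (.down e) ((Ty.boolImp r).tagged π)
  | sub {Γ : TEnv S} {e : Expr S} {T T' : Ty S} : HasTy M Γ e T' → Subty M Γ T' T → HasTy M Γ e T

/-- Statement typing, `Γ; σ ⊢ s`. -/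
inductive StmtTy {S : Sig.{u}} (M : PolicyModule S) : TEnv S → Stmt S → Prop
  | letIn {Γ : TEnv S} {e : Expr S} {s : Stmt S} {T : Ty S} : HasTy M Γ e T →
      StmtTy M (.bind T :: Γ) s → StmtTy M Γ (.letIn e s)
  | print {Γ : TEnv S} {x y : Expr S} {π : Policy S} :
      HasTy M Γ x ((Ty.viewer π).tagged π) →
      HasTy M Γ y ((Ty.sc .str Refn.top).tagged π) → StmtTy M Γ (.print x y)
  | set {Γ : TEnv S} {x y : Expr S} {T : Ty S} : HasTy M Γ x (Ty.reft T) → HasTy M Γ y T →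
      StmtTy M Γ (.set x y)

/-- Well-formed policy modules: the types of constants are closed, built-in functions and fields
take arguments of primitive types, and every application of a built-in function or field to an
argument in its domain has the declared type. -/
structure PolicyModule.WellFormed {S : Sig.{u}} (M : PolicyModule S) : Prop where
  loc_closed : ∀ l, (M.locTy l).Closed
  fn_closed : ∀ f, (M.fnTy f).Closed
  fn_sound : ∀ f, ∃ B r T, BTy.IsPrim B ∧ M.fnTy f = .fn (.sc B r) T ∧
    ∀ I c, B.HasSort (.const c) → r I (.const c) →
      ∃ d, M.delta f c = some d ∧ Subty M [] (M.ty d) (T.subst fun _ => .const c)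

/-- Every location holds a value of its declared type. -/
def PolicyModule.StoreTy {S : Sig.{u}} (M : PolicyModule S) (σ : Store S) : Prop :=
  ∀ l, HasTy M [] (σ.mem l).toExpr (M.locTy l)

/-! ### Observational equivalence -/

/-- The policy of the location `l` allows `o` to see it in the memory `σ`. (The policy is closed,
so the interpretation it is evaluated in is irrelevant.) -/
def PolicyModule.Visible {S : Sig.{u}} (M : PolicyModule S) (o : S.User) (σ : Mem S)
    (l : S.Loc) : Prop :=
  (M.locTy l).pol ⟨σ, fun _ => .const (.bool true)⟩ σ o

/-- `obs_o(σ₁, σ₂)` -/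
def PolicyModule.obs {S : Sig.{u}} (M : PolicyModule S) (o : S.User) (σ₁ σ₂ : Store S) :
    Set S.Loc :=
  {l | M.Visible o σ₁.mem l ∨ M.Visible o σ₂.mem l}

/-- `σ₁ ∼_o σ₂` -/
def PolicyModule.ObsEquiv {S : Sig.{u}} (M : PolicyModule S) (o : S.User)
    (σ₁ σ₂ : Store S) : Prop :=
  σ₁.out o = σ₂.out o ∧ ∀ l ∈ M.obs o σ₁ σ₂, σ₁.mem l = σ₂.mem l

/-! ### Substitution -/

theorem Expr.rename_eq_subst {S : Sig.{u}} (e : Expr S) (ξ : ℕ → ℕ) :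
    e.rename ξ = e.subst fun i => .var (ξ i) := by
  induction e generalizing ξ with
  | lam e ih =>
    simp only [Expr.rename, Expr.subst, ih]
    congr 2
    funext i
    cases i <;> rfl
  | _ => simp_all [Expr.rename, Expr.subst]

theorem Expr.subst_var {S : Sig.{u}} (e : Expr S) : e.subst .var = e := by
  induction e with
  | lam e ih =>
    have : Expr.liftSub (S := S) .var = .var := by funext i; cases i <;> rfl
    simp [Expr.subst, this, ih]
  | _ => simp_all [Expr.subst]

theorem Expr.subst_rename {S : Sig.{u}} (e : Expr S) (ξ : ℕ → ℕ) (θ : ℕ → Expr S) :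
    (e.rename ξ).subst θ = e.subst fun i => θ (ξ i) := by
  induction e generalizing ξ θ with
  | lam e ih =>
    simp only [Expr.rename, Expr.subst, ih]
    congr 2
    funext i
    cases i <;> rfl
  | _ => simp_all [Expr.rename, Expr.subst]

theorem Expr.rename_rename {S : Sig.{u}} (e : Expr S) (ξ ξ' : ℕ → ℕ) :
    (e.rename ξ).rename ξ' = e.rename fun i => ξ' (ξ i) := by
  rw [Expr.rename_eq_subst (e.rename ξ), Expr.subst_rename, Expr.rename_eq_subst]

theorem Expr.rename_subst {S : Sig.{u}} (e : Expr S) (ξ : ℕ → ℕ) (θ : ℕ → Expr S) :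
    (e.subst θ).rename ξ = e.subst fun i => (θ i).rename ξ := by
  induction e generalizing ξ θ with
  | lam e ih =>
    simp only [Expr.rename, Expr.subst, ih]
    congr 2
    funext i
    cases i with
    | zero => rfl
    | succ i =>
      simp only [Expr.liftSub, Expr.rename_rename]
      rfl
  | _ => simp_all [Expr.rename, Expr.subst]

theorem Expr.subst_comp {S : Sig.{u}} (e : Expr S) (θ θ' : ℕ → Expr S) :
    (e.subst θ).subst θ' = e.subst fun i => (θ i).subst θ' := by
  induction e generalizing θ θ' with
  | lam e ih =>
    simp only [Expr.subst, ih]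
    congr 2
    funext i
    cases i with
    | zero => rfl
    | succ i =>
      simp only [Expr.liftSub, Expr.subst_rename, Expr.rename_subst]
  | _ => simp_all [Expr.subst]

/-- Extend a sequence by a new innermost entry. -/
def consVar {α : Type*} (a : α) (f : ℕ → α) : ℕ → α
  | 0 => a
  | i + 1 => f i

theorem Expr.subst_liftSub_single {S : Sig.{u}} (e : Expr S) (θ : ℕ → Expr S) (a : Expr S) :
    (e.subst (liftSub θ)).subst (single a) = e.subst (consVar a θ) := by
  rw [Expr.subst_comp]
  congr 1
  funext i
  cases i with
  | zero => rfl
  | succ i =>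
    simp only [liftSub, Expr.subst_rename]
    exact Expr.subst_var _

theorem Stmt.subst_comp {S : Sig.{u}} (s : Stmt S) (θ θ' : ℕ → Expr S) :
    (s.subst θ).subst θ' = s.subst fun i => (θ i).subst θ' := by
  induction s generalizing θ θ' with
  | letIn e s ih =>
    simp only [Stmt.subst, ih, Expr.subst_comp]
    congr 2
    funext i
    cases i with
    | zero => rfl
    | succ i =>
      simp only [Expr.liftSub, Expr.subst_rename, Expr.rename_subst]
  | _ => simp_all [Stmt.subst, Expr.subst_comp]

theorem Stmt.subst_liftSub_single {S : Sig.{u}} (s : Stmt S) (θ : ℕ → Expr S) (a : Expr S) :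
    (s.subst (Expr.liftSub θ)).subst (Expr.single a) = s.subst (consVar a θ) := by
  rw [Stmt.subst_comp]
  congr 1
  funext i
  cases i with
  | zero => rfl
  | succ i =>
    simp only [Expr.liftSub, Expr.subst_rename]
    exact Expr.subst_var _

/-- Substitution in a value. -/
def Val.subst {S : Sig.{u}} (θ : ℕ → Expr S) : Val S → Val S
  | .const c => .const c
  | .lam e => .lam (e.subst (Expr.liftSub θ))

theorem Val.toExpr_subst {S : Sig.{u}} (v : Val S) (θ : ℕ → Expr S) :
    v.toExpr.subst θ = (v.subst θ).toExpr := by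
  cases v <;> rfl

theorem Val.toExpr_injective {S : Sig.{u}} : Function.Injective (Val.toExpr (S := S)) := by
  intro v w h
  cases v <;> cases w <;> simp_all [Val.toExpr]

theorem Expr.inst_subst {S : Sig.{u}} (e : Expr S) (v : Val S) (θ : ℕ → Expr S) :
    (e.inst v).subst θ = (e.subst (liftSub θ)).inst (v.subst θ) := by
  rw [Expr.inst, Expr.inst, Expr.subst_liftSub_single, Expr.subst_comp, ← Val.toExpr_subst]
  congr 1
  funext i
  cases i <;> rfl

/-! ### Typed expressions are closed -/

theorem HasTy.subst_eq_self {S : Sig.{u}} {M : PolicyModule S} {Γ : TEnv S} {e : Expr S}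
    {T : Ty S} (h : HasTy M Γ e T) (θ : ℕ → Expr S)
    (hθ : ∀ i T, Lookup Γ i T → θ i = .var i) : e.subst θ = e := by
  induction h generalizing θ with
  | const => rfl
  | var hl => exact hθ _ _ hl
  | lam _ ih =>
    simp only [Expr.subst]
    rw [ih]
    intro i T hl
    cases hl with
    | here => rfl
    | there _ hl => simp only [Expr.liftSub, hθ _ _ hl]; rfl
  | app _ _ _ ih₁ ih₂ => simp only [Expr.subst, ih₁ θ hθ, ih₂ θ hθ]
  | appConst _ _ ih₁ ih₂ => simp only [Expr.subst, ih₁ θ hθ, ih₂ θ hθ]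
  | get _ _ ih => simp only [Expr.subst, ih θ hθ]
  | getTag _ _ ih => simp only [Expr.subst, ih θ hθ]
  | @ite Γ _ _ _ _ _ _ _ _ ih ih₁ ih₂ =>
    have hc : ∀ (p : Cond S) (i : ℕ) (T : Ty S), Lookup (.cond p :: Γ) i T → θ i = .var i := by
      intro p i T hl
      cases hl with
      | skip _ hl => exact hθ _ _ hl
    simp only [Expr.subst, ih θ hθ, ih₁ θ (hc _), ih₂ θ (hc _)]
  | bind _ _ ih₁ ih₂ => simp only [Expr.subst, ih₁ θ hθ, ih₂ θ hθ]
  | down _ ih => simp only [Expr.subst, ih θ hθ]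
  | sub _ _ ih => exact ih θ hθ

theorem StmtTy.subst_eq_self {S : Sig.{u}} {M : PolicyModule S} {Γ : TEnv S} {s : Stmt S}
    (h : StmtTy M Γ s) (θ : ℕ → Expr S)
    (hθ : ∀ i T, Lookup Γ i T → θ i = .var i) : s.subst θ = s := by
  induction h generalizing θ with
  | letIn he _ ih =>
    simp only [Stmt.subst, he.subst_eq_self θ hθ]
    rw [ih]
    intro i T hl
    cases hl with
    | here => rfl
    | there _ hl => simp only [Expr.liftSub, hθ _ _ hl]; rfl
  | print hx hy => simp only [Stmt.subst, hx.subst_eq_self θ hθ, hy.subst_eq_self θ hθ]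
  | set hx hy => simp only [Stmt.subst, hx.subst_eq_self θ hθ, hy.subst_eq_self θ hθ]

/-! ### Weak call-by-value reduction -/

/-- Weak evaluation: evaluation neither under binders nor in the branches of a conditional. -/
inductive HStep {S : Sig.{u}} (M : PolicyModule S) (σ : Mem S) : Expr S → Expr S → Prop
  | beta (e : Expr S) (v : Val S) : HStep M σ (.app (.lam e) v.toExpr) (e.inst v)
  | delta {f : S.Fn} {c d : Const S} : M.delta f c = some d →
      HStep M σ (.app (.const (.fn f)) (.const c)) (.const d)
  | get (l : S.Loc) : HStep M σ (.get (.const (.loc l))) (σ l).toExpr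
  | iteTrue (e₁ e₂ : Expr S) : HStep M σ (.ite (.const (.bool true)) e₁ e₂) e₁
  | iteFalse (e₁ e₂ : Expr S) : HStep M σ (.ite (.const (.bool false)) e₁ e₂) e₂
  | bind (v : Val S) (e : Expr S) : HStep M σ (.bind v.toExpr (.lam e)) (e.inst v)
  | down (e : Expr S) : HStep M σ (.down e) e
  | appL {e e' : Expr S} (e₂ : Expr S) : HStep M σ e e' → HStep M σ (.app e e₂) (.app e' e₂)
  | appR (v : Val S) {e e' : Expr S} : HStep M σ e e' →
      HStep M σ (.app v.toExpr e) (.app v.toExpr e')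
  | getC {e e' : Expr S} : HStep M σ e e' → HStep M σ (.get e) (.get e')
  | iteC {e e' : Expr S} (e₁ e₂ : Expr S) : HStep M σ e e' →
      HStep M σ (.ite e e₁ e₂) (.ite e' e₁ e₂)
  | bindL {e e' : Expr S} (e₂ : Expr S) : HStep M σ e e' →
      HStep M σ (.bind e e₂) (.bind e' e₂)
  | bindR (v : Val S) {e e' : Expr S} : HStep M σ e e' →
      HStep M σ (.bind v.toExpr e) (.bind v.toExpr e')

/-- Weak evaluation to `e'` up to steps in positions that weak evaluation does not reach. -/
inductive Std {S : Sig.{u}} (M : PolicyModule S) (σ : Mem S) : Expr S → Expr S → Prop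
  | head {e e₁ e' : Expr S} : HStep M σ e e₁ → Std M σ e₁ e' → Std M σ e e'
  | const (c : Const S) : Std M σ (.const c) (.const c)
  | lam {e e' : Expr S} : Std M σ e e' → Std M σ (.lam e) (.lam e')
  | var (i : ℕ) : Std M σ (.var i) (.var i)
  | app {a b a' b' : Expr S} : Std M σ a a' → Std M σ b b' → Std M σ (.app a b) (.app a' b')
  | ite {e a b e' a' b' : Expr S} : Std M σ e e' → Std M σ a a' → Std M σ b b' →
      Std M σ (.ite e a b) (.ite e' a' b')
  | get {e e' : Expr S} : Std M σ e e' → Std M σ (.get e) (.get e')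
  | bind {a b a' b' : Expr S} : Std M σ a a' → Std M σ b b' →
      Std M σ (.bind a b) (.bind a' b')
  | down {e e' : Expr S} : Std M σ e e' → Std M σ (.down e) (.down e')

/-- Stores without free variables. -/
def Mem.NoFree {S : Sig.{u}} (σ : Mem S) : Prop :=
  ∀ l θ, (σ l).toExpr.subst θ = (σ l).toExpr

section Standardization

variable {S : Sig.{u}} {M : PolicyModule S} {σ : Mem S}

theorem HStep.subst (hσ : Mem.NoFree σ) {e e' : Expr S} (h : HStep M σ e e')
    (θ : ℕ → Expr S) : HStep M σ (e.subst θ) (e'.subst θ) := by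
  induction h with
  | beta e v =>
    rw [Expr.inst_subst]
    simp only [Expr.subst, Val.toExpr_subst]
    exact .beta _ _
  | delta h => exact .delta h
  | get l =>
    rw [hσ l θ]
    exact .get l
  | iteTrue => exact .iteTrue _ _
  | iteFalse => exact .iteFalse _ _
  | bind v e =>
    rw [Expr.inst_subst]
    simp only [Expr.subst, Val.toExpr_subst]
    exact .bind _ _
  | down => exact .down _
  | appL _ _ ih => exact .appL _ ih
  | appR v _ ih =>
    simp only [Expr.subst, Val.toExpr_subst]
    exact .appR _ ih
  | getC _ ih => exact .getC ih
  | iteC _ _ _ ih => exact .iteC _ _ ih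
  | bindL _ _ ih => exact .bindL _ ih
  | bindR v _ ih =>
    simp only [Expr.subst, Val.toExpr_subst]
    exact .bindR _ ih

theorem Std.refl (e : Expr S) : Std M σ e e := by
  induction e with
  | const => exact .const _
  | lam _ ih => exact .lam ih
  | var => exact .var _
  | app _ _ ih₁ ih₂ => exact .app ih₁ ih₂
  | ite _ _ _ ih ih₁ ih₂ => exact .ite ih ih₁ ih₂
  | get _ ih => exact .get ih
  | bind _ _ ih₁ ih₂ => exact .bind ih₁ ih₂
  | down _ ih => exact .down ih

theorem Std.heads {e e₁ e' : Expr S} (h : Relation.ReflTransGen (HStep M σ) e e₁)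
    (h' : Std M σ e₁ e') : Std M σ e e' := by
  induction h using Relation.ReflTransGen.head_induction_on with
  | refl => exact h'
  | head h _ ih => exact .head h ih

theorem Std.rename (hσ : Mem.NoFree σ) {e e' : Expr S} (h : Std M σ e e') (ξ : ℕ → ℕ) :
    Std M σ (e.rename ξ) (e'.rename ξ) := by
  induction h generalizing ξ with
  | head h _ ih =>
    refine .head ?_ (ih ξ)
    rw [Expr.rename_eq_subst, Expr.rename_eq_subst]
    exact h.subst hσ _
  | const => exact .const _
  | lam _ ih => exact .lam (ih _)
  | var => exact .var _
  | app _ _ ih₁ ih₂ => exact .app (ih₁ ξ) (ih₂ ξ)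
  | ite _ _ _ ih ih₁ ih₂ => exact .ite (ih ξ) (ih₁ ξ) (ih₂ ξ)
  | get _ ih => exact .get (ih ξ)
  | bind _ _ ih₁ ih₂ => exact .bind (ih₁ ξ) (ih₂ ξ)
  | down _ ih => exact .down (ih ξ)

theorem Std.subst (hσ : Mem.NoFree σ) {e e' : Expr S} (h : Std M σ e e') {θ θ' : ℕ → Expr S}
    (hθ : ∀ i, Std M σ (θ i) (θ' i)) : Std M σ (e.subst θ) (e'.subst θ') := by
  induction h generalizing θ θ' with
  | head h _ ih => exact .head (h.subst hσ _) (ih hθ)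
  | const => exact .const _
  | lam _ ih =>
    refine .lam (ih fun i => ?_)
    cases i with
    | zero => exact .var 0
    | succ i => exact (hθ i).rename hσ _
  | var i => exact hθ i
  | app _ _ ih₁ ih₂ => exact .app (ih₁ hθ) (ih₂ hθ)
  | ite _ _ _ ih ih₁ ih₂ => exact .ite (ih hθ) (ih₁ hθ) (ih₂ hθ)
  | get _ ih => exact .get (ih hθ)
  | bind _ _ ih₁ ih₂ => exact .bind (ih₁ hθ) (ih₂ hθ)
  | down _ ih => exact .down (ih hθ)

theorem Std.inst (hσ : Mem.NoFree σ) {e e' : Expr S} (h : Std M σ e e') {v v' : Val S}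
    (hv : Std M σ v.toExpr v'.toExpr) : Std M σ (e.inst v) (e'.inst v') := by
  refine h.subst hσ fun i => ?_
  cases i with
  | zero => exact hv
  | succ i => exact .var i

theorem Std.of_const {e : Expr S} {c : Const S} (h : Std M σ e (.const c)) :
    Relation.ReflTransGen (HStep M σ) e (.const c) := by
  generalize he : Expr.const c = e' at h
  induction h with
  | head h _ ih => exact .head h (ih he)
  | const => cases he; exact .refl
  | _ => cases he

theorem Std.of_lam {e b' : Expr S} (h : Std M σ e (.lam b')) :
    ∃ b, Relation.ReflTransGen (HStep M σ) e (.lam b) ∧ Std M σ b b' := by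
  generalize he : Expr.lam b' = e' at h
  induction h with
  | head h _ ih =>
    obtain ⟨b, h₁, h₂⟩ := ih he
    exact ⟨b, .head h h₁, h₂⟩
  | lam h => cases he; exact ⟨_, .refl, h⟩
  | _ => cases he

theorem Std.of_val {e : Expr S} {v' : Val S} (h : Std M σ e v'.toExpr) :
    ∃ v : Val S, Relation.ReflTransGen (HStep M σ) e v.toExpr ∧
      Std M σ v.toExpr v'.toExpr := by
  cases v' with
  | const c => exact ⟨.const c, h.of_const, .const c⟩
  | lam b' =>
    obtain ⟨b, h₁, h₂⟩ := h.of_lam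
    exact ⟨.lam b, h₁, .lam h₂⟩

theorem Std.const_eq {c : Const S} {e : Expr S} (h : Std M σ (.const c) e) : e = .const c := by
  cases h with
  | head h _ => cases h
  | const => rfl

theorem HStep.app_heads {a b : Expr S} {v w : Val S}
    (ha : Relation.ReflTransGen (HStep M σ) a v.toExpr)
    (hb : Relation.ReflTransGen (HStep M σ) b w.toExpr) :
    Relation.ReflTransGen (HStep M σ) (.app a b) (.app v.toExpr w.toExpr) :=
  (ha.lift (fun x => Expr.app x b) fun _ _ h => .appL _ h).trans
    (hb.lift (fun x => Expr.app v.toExpr x) fun _ _ h => .appR _ h)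

theorem HStep.bind_heads {a b : Expr S} {v w : Val S}
    (ha : Relation.ReflTransGen (HStep M σ) a v.toExpr)
    (hb : Relation.ReflTransGen (HStep M σ) b w.toExpr) :
    Relation.ReflTransGen (HStep M σ) (.bind a b) (.bind v.toExpr w.toExpr) :=
  (ha.lift (fun x => Expr.bind x b) fun _ _ h => .bindL _ h).trans
    (hb.lift (fun x => Expr.bind v.toExpr x) fun _ _ h => .bindR _ h)

theorem Std.step (hσ : Mem.NoFree σ) {e e' e'' : Expr S} (h : Std M σ e e')
    (hs : Step M σ e' e'') : Std M σ e e'' := by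
  induction h generalizing e'' with
  | head h _ ih => exact .head h (ih hs)
  | const c =>
    cases hs
  | lam _ ih =>
    cases hs with
    | lam hs => exact .lam (ih hs)
  | var => cases hs
  | @app a b a' b' h₁ h₂ ih₁ ih₂ =>
    generalize he : Expr.app a' b' = x at hs
    cases hs <;> cases he
    case app.beta.refl c v =>
      obtain ⟨c₀, hc₀, hc⟩ := h₁.of_lam
      obtain ⟨v₀, hv₀, hv⟩ := h₂.of_val
      exact (hc.inst hσ hv).head (.beta c₀ v₀) |>.heads
        (HStep.app_heads (v := .lam c₀) hc₀ hv₀)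
    case app.delta.refl hd =>
      exact ((Std.const _).head (.delta hd)).heads
        (HStep.app_heads (v := .const _) (w := .const _) h₁.of_const h₂.of_const)
    case app.appL.refl hs => exact .app (ih₁ hs) h₂
    case app.appR.refl hs => exact .app h₁ (ih₂ hs)
  | @ite e a b e' a' b' h h₁ h₂ ih ih₁ ih₂ =>
    generalize he : Expr.ite e' a' b' = x at hs
    cases hs <;> cases he
    case ite.iteTrue.refl =>
      exact (h₁.head (.iteTrue _ _)).heads
        (h.of_const.lift (fun x => Expr.ite x a b) fun _ _ h => .iteC _ _ h)
    case ite.iteFalse.refl =>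
      exact (h₂.head (.iteFalse _ _)).heads
        (h.of_const.lift (fun x => Expr.ite x a b) fun _ _ h => .iteC _ _ h)
    case ite.iteC.refl hs => exact .ite (ih hs) h₁ h₂
    case ite.iteThen.refl hs => exact .ite h (ih₁ hs) h₂
    case ite.iteElse.refl hs => exact .ite h h₁ (ih₂ hs)
  | get h ih =>
    cases hs with
    | get l =>
      exact ((Std.refl _).head (.get l)).heads
        (h.of_const.lift (fun x => Expr.get x) fun _ _ h => .getC h)
    | getC hs => exact .get (ih hs)
  | @bind a b a' b' h₁ h₂ ih₁ ih₂ =>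
    generalize he : Expr.bind a' b' = x at hs
    cases hs <;> cases he
    case bind.bind.refl v c =>
      obtain ⟨c₀, hc₀, hc⟩ := h₂.of_lam
      obtain ⟨v₀, hv₀, hv⟩ := h₁.of_val
      exact (hc.inst hσ hv).head (.bind v₀ c₀) |>.heads
        (HStep.bind_heads (w := .lam c₀) hv₀ hc₀)
    case bind.bindL.refl hs => exact .bind (ih₁ hs) h₂
    case bind.bindR.refl hs => exact .bind h₁ (ih₂ hs)
  | down h ih =>
    cases hs with
    | down => exact h.head (.down _)

theorem Std.steps (hσ : Mem.NoFree σ) {e e' e'' : Expr S} (h : Std M σ e e')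
    (hs : Relation.ReflTransGen (Step M σ) e' e'') : Std M σ e e'' := by
  induction hs with
  | refl => exact h
  | tail _ hs ih => exact ih.step hσ hs

end Standardization

/-! ### Big-step evaluation with fuel -/

/-- `Ev M σ k e v k'`: the expression `e` evaluates to `v`; of the fuel `k` that pays for the
steps that look up a location or a built-in function, `k'` is left. -/
inductive Ev {S : Sig.{u}} (M : PolicyModule S) (σ : Mem S) : ℕ → Expr S → Val S → ℕ → Prop
  | const (k : ℕ) (c : Const S) : Ev M σ k (.const c) (.const c) k
  | lam (k : ℕ) (e : Expr S) : Ev M σ k (.lam e) (.lam e) k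
  | beta {k k₁ k₂ k₃ : ℕ} {e₁ e₂ e : Expr S} {a v : Val S} : Ev M σ k e₁ (.lam e) k₁ →
      Ev M σ k₁ e₂ a k₂ → Ev M σ k₂ (e.inst a) v k₃ → Ev M σ k (.app e₁ e₂) v k₃
  | delta {k k₁ k₂ : ℕ} {e₁ e₂ : Expr S} {f : S.Fn} {c d : Const S} :
      Ev M σ k e₁ (.const (.fn f)) k₁ → Ev M σ k₁ e₂ (.const c) (k₂ + 1) →
      M.delta f c = some d → Ev M σ k (.app e₁ e₂) (.const d) k₂
  | get {k k₁ : ℕ} {e : Expr S} {l : S.Loc} : Ev M σ k e (.const (.loc l)) (k₁ + 1) →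
      Ev M σ k (.get e) (σ l) k₁
  | iteTrue {k k₁ k₂ : ℕ} {e e₁ e₂ : Expr S} {v : Val S} :
      Ev M σ k e (.const (.bool true)) k₁ → Ev M σ k₁ e₁ v k₂ → Ev M σ k (.ite e e₁ e₂) v k₂
  | iteFalse {k k₁ k₂ : ℕ} {e e₁ e₂ : Expr S} {v : Val S} :
      Ev M σ k e (.const (.bool false)) k₁ → Ev M σ k₁ e₂ v k₂ → Ev M σ k (.ite e e₁ e₂) v k₂
  | bind {k k₁ k₂ k₃ : ℕ} {e₁ e₂ e : Expr S} {a v : Val S} : Ev M σ k e₁ a k₁ →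
      Ev M σ k₁ e₂ (.lam e) k₂ → Ev M σ k₂ (e.inst a) v k₃ → Ev M σ k (.bind e₁ e₂) v k₃
  | down {k k₁ : ℕ} {e : Expr S} {v : Val S} : Ev M σ k e v k₁ → Ev M σ k (.down e) v k₁

section Evaluation

variable {S : Sig.{u}} {M : PolicyModule S} {σ : Mem S}

theorem Ev.val (k : ℕ) (v : Val S) : Ev M σ k v.toExpr v k := by
  cases v
  · exact .const _ _
  · exact .lam _ _

theorem Ev.of_val {k k' : ℕ} {v w : Val S} (h : Ev M σ k v.toExpr w k') : w = v ∧ k' = k := by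
  cases v <;> cases h <;> exact ⟨rfl, rfl⟩

theorem Ev.le {k k' : ℕ} {e : Expr S} {v : Val S} (h : Ev M σ k e v k') : k' ≤ k := by
  induction h <;> omega

theorem Ev.add {k k' : ℕ} {e : Expr S} {v : Val S} (h : Ev M σ k e v k') (n : ℕ) :
    Ev M σ (k + n) e v (k' + n) := by
  induction h with
  | const => exact .const _ _
  | lam => exact .lam _ _
  | beta _ _ _ ih₁ ih₂ ih₃ => exact .beta ih₁ ih₂ ih₃
  | delta _ _ hd ih₁ ih₂ => exact .delta ih₁ (by rw [Nat.add_right_comm] at ih₂; exact ih₂) hd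
  | get _ ih => exact .get (by rw [Nat.add_right_comm] at ih; exact ih)
  | iteTrue _ _ ih₁ ih₂ => exact .iteTrue ih₁ ih₂
  | iteFalse _ _ ih₁ ih₂ => exact .iteFalse ih₁ ih₂
  | bind _ _ _ ih₁ ih₂ ih₃ => exact .bind ih₁ ih₂ ih₃
  | down _ ih => exact .down ih

theorem HStep.expand {e e' : Expr S} (h : HStep M σ e e') {k k' : ℕ} {v : Val S}
    (hv : Ev M σ k e' v k') : Ev M σ k e v k' ∨ Ev M σ (k + 1) e v k' := by
  induction h generalizing k k' v with
  | beta e a => exact .inl (.beta (.lam _ _) (.val _ _) hv)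
  | delta hd =>
    cases hv
    exact .inr (.delta (.const _ _) (.const _ _) hd)
  | get l =>
    obtain ⟨rfl, rfl⟩ := hv.of_val
    exact .inr (.get (.const _ _))
  | iteTrue => exact .inl (.iteTrue (.const _ _) hv)
  | iteFalse => exact .inl (.iteFalse (.const _ _) hv)
  | bind a e => exact .inl (.bind (.val _ _) (.lam _ _) hv)
  | down => exact .inl (.down hv)
  | appL _ _ ih =>
    cases hv with
    | beta h₁ h₂ h₃ => exact (ih h₁).imp (.beta · h₂ h₃) (.beta · h₂ h₃)
    | delta h₁ h₂ hd => exact (ih h₁).imp (.delta · h₂ hd) (.delta · h₂ hd)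
  | appR w _ ih =>
    cases hv with
    | beta h₁ h₂ h₃ =>
      obtain ⟨rfl, rfl⟩ := h₁.of_val
      exact (ih h₂).imp (.beta (.val _ _) · h₃) (.beta (.val _ _) · h₃)
    | delta h₁ h₂ hd =>
      obtain ⟨rfl, rfl⟩ := h₁.of_val
      exact (ih h₂).imp (.delta (.val _ _) · hd) (.delta (.val _ _) · hd)
  | getC _ ih =>
    cases hv with
    | get h => exact (ih h).imp .get .get
  | iteC _ _ _ ih =>
    cases hv with
    | iteTrue h h₁ => exact (ih h).imp (.iteTrue · h₁) (.iteTrue · h₁)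
    | iteFalse h h₁ => exact (ih h).imp (.iteFalse · h₁) (.iteFalse · h₁)
  | bindL _ _ ih =>
    cases hv with
    | bind h₁ h₂ h₃ => exact (ih h₁).imp (.bind · h₂ h₃) (.bind · h₂ h₃)
  | bindR w _ ih =>
    cases hv with
    | bind h₁ h₂ h₃ =>
      obtain ⟨rfl, rfl⟩ := h₁.of_val
      exact (ih h₂).imp (.bind (.val _ _) · h₃) (.bind (.val _ _) · h₃)

theorem Ev.of_heads {e : Expr S} {v : Val S}
    (h : Relation.ReflTransGen (HStep M σ) e v.toExpr) : ∃ k, Ev M σ k e v 0 := by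
  induction h using Relation.ReflTransGen.head_induction_on with
  | refl => exact ⟨0, .val _ _⟩
  | head h _ ih =>
    obtain ⟨k, hk⟩ := ih
    rcases h.expand hk with h | h
    exacts [⟨_, h⟩, ⟨_, h⟩]

/-- Evaluation to a value, with any amount of fuel left. -/
theorem Std.ev {e : Expr S} {v' : Val S} (h : Std M σ e v'.toExpr) :
    ∃ v : Val S, (∀ k', ∃ k, Ev M σ k e v k') ∧ Std M σ v.toExpr v'.toExpr := by
  obtain ⟨v, h₁, h₂⟩ := h.of_val
  obtain ⟨k, hk⟩ := Ev.of_heads h₁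
  exact ⟨v, fun k' => ⟨k + k', by simpa using hk.add k'⟩, h₂⟩

end Evaluation

/-! ### Instances of types -/

mutual

theorem BTy.map_map {S : Sig.{u}} (f g : Interp S → Interp S) :
    ∀ B : BTy S, (B.map f).map g = B.map fun I => f (g I)
  | .bool => rfl
  | .str => rfl
  | .user => rfl
  | .tag T π => by simp only [BTy.map, Ty.map_map f g T]
  | .ref T => by simp only [BTy.map, Ty.map_map f g T]

theorem Ty.map_map {S : Sig.{u}} (f g : Interp S → Interp S) :
    ∀ T : Ty S, (T.map f).map g = T.map fun I => f (g I)
  | .sc B r => by simp only [Ty.map, BTy.map_map f g B]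
  | .fn Tx T => by
    simp only [Ty.map, Ty.map_map f g Tx, Ty.map_map (liftMap f) (liftMap g) T]
    rfl

end

mutual

theorem BTy.hasSort_map {S : Sig.{u}} (f : Interp S → Interp S) (v : Val S) :
    ∀ B : BTy S, (B.map f).HasSort v ↔ B.HasSort v
  | .bool => Iff.rfl
  | .str => Iff.rfl
  | .user => Iff.rfl
  | .tag T _ => Ty.hasSort_map f v T
  | .ref _ => Iff.rfl

theorem Ty.hasSort_map {S : Sig.{u}} (f : Interp S → Interp S) (v : Val S) :
    ∀ T : Ty S, (T.map f).HasSort v ↔ T.HasSort v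
  | .sc B _ => BTy.hasSort_map f v B
  | .fn _ _ => Iff.rfl

end

/-- A base type under a fixed interpretation of its parameters. -/
def BTy.at {S : Sig.{u}} (B : BTy S) (I : Interp S) : BTy S := B.map fun _ => I

/-- A type under a fixed interpretation of its parameters. -/
def Ty.at {S : Sig.{u}} (T : Ty S) (I : Interp S) : Ty S := T.map fun _ => I

/-- The type is a refinement of a primitive type. -/
def Ty.IsPrim {S : Sig.{u}} : Ty S → Prop
  | .sc B _ => B.IsPrim
  | .fn _ _ => False

/-- The value is a constant. -/
def Val.IsConst {S : Sig.{u}} (v : Val S) : Prop := ∃ c, v = .const c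

section Instances

variable {S : Sig.{u}}

theorem Ty.at_subst (T : Ty S) (t : Interp S → Val S) (I : Interp S) :
    (T.subst t).at I = T.at (I.push (t I)) := Ty.map_map _ _ _

theorem Ty.at_weaken (T : Ty S) (I : Interp S) (v : Val S) :
    T.weaken.at (I.push v) = T.at I := Ty.map_map _ _ _

theorem Ty.hasSort_congr {T T' : Ty S} {I I' : Interp S} (h : T.at I = T'.at I') (v : Val S) :
    T.HasSort v ↔ T'.HasSort v := by
  rw [← Ty.hasSort_map (fun _ => I) v T, ← Ty.hasSort_map (fun _ => I') v T']
  exact iff_of_eq (congrArg (Ty.HasSort · v) h)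

theorem Ty.isPrim_map (T : Ty S) (f : Interp S → Interp S) : (T.map f).IsPrim ↔ T.IsPrim := by
  cases T with
  | sc B r =>
    cases B <;> simp only [Ty.map, BTy.map, Ty.IsPrim]
    all_goals exact ⟨nofun, nofun⟩
  | fn => rfl

theorem Ty.isPrim_congr {T T' : Ty S} {I I' : Interp S} (h : T.at I = T'.at I') :
    T.IsPrim ↔ T'.IsPrim := by
  rw [← Ty.isPrim_map T fun _ => I, ← Ty.isPrim_map T' fun _ => I']
  exact iff_of_eq (congrArg Ty.IsPrim h)

theorem Ty.at_sc {B B' : BTy S} {r r' : Refn S} {I I' : Interp S}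
    (h : (Ty.sc B r).at I = (Ty.sc B' r').at I') : B.at I = B'.at I' ∧ r I = r' I' := by
  simp only [Ty.at, Ty.map, Ty.sc.injEq] at h
  exact ⟨h.1, congrFun h.2 I⟩

theorem BTy.at_tag {T T' : Ty S} {π π' : Policy S} {I I' : Interp S}
    (h : (BTy.tag T π).at I = (BTy.tag T' π').at I') : T.at I = T'.at I' ∧ π I = π' I' := by
  simp only [BTy.at, BTy.map, BTy.tag.injEq] at h
  exact ⟨h.1, congrFun h.2 I⟩

theorem BTy.at_ref {T T' : Ty S} {I I' : Interp S}
    (h : (BTy.ref T).at I = (BTy.ref T').at I') : T.at I = T'.at I' := by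
  simp only [BTy.at, BTy.map, BTy.ref.injEq] at h
  exact h

theorem Ty.at_fn {Tx Tx' T T' : Ty S} {I I' : Interp S}
    (h : (Ty.fn Tx T).at I = (Ty.fn Tx' T').at I') :
    Tx.at I = Tx'.at I' ∧ ∀ a, T.at (I.push a) = T'.at (I'.push a) := by
  simp only [Ty.at, Ty.map, Ty.fn.injEq] at h
  refine ⟨h.1, fun a => ?_⟩
  have := congrArg (Ty.map fun _ => I.push a) h.2
  rw [Ty.map_map, Ty.map_map] at this
  exact this

theorem Ty.Closed.at_eq {T : Ty S} (h : T.Closed) (I : Interp S) : T.at I = T := h _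

end Instances

/-! ### Valid values of a single run -/

mutual

/-- The value `v` of a base type is valid in the world `I`, for evaluations with fuel `k`. -/
def BTy.Valid {S : Sig.{u}} (M : PolicyModule S) : BTy S → ℕ → Interp S → Val S → Prop
  | .bool, _, _, v => ∃ b, v = .const (.bool b)
  | .str, _, _, v => ∃ w, v = .const (.str w)
  | .user, _, _, v => ∃ a, v = .const (.user a)
  | .tag T _, k, I, v => Ty.Valid M T k I v
  | .ref T, _, I, v => ∃ l, v = .const (.loc l) ∧ T.at I = M.locTy l

/-- The value `v` of a type is valid in the world `I`, for evaluations with fuel `k`. -/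
def Ty.Valid {S : Sig.{u}} (M : PolicyModule S) : Ty S → ℕ → Interp S → Val S → Prop
  | .sc B r, k, I, v => BTy.Valid M B k I v ∧ r I v
  | .fn Tx T, k, I, f => (Ty.fn Tx T).HasSort f ∧ (f.IsConst → Tx.IsPrim) ∧
      ∀ j ≤ k, ∀ a, Ty.Valid M Tx j I a → ∀ v j', Ev M I.mem j (.app f.toExpr a.toExpr) v j' →
        Ty.Valid M T j' (I.push a) v

end

/-! ### Values of a run, seen from another world -/

mutual

/-- The value `v` that a run in the world `I` computes is, as far as the observer `o` can see it
there, also valid in the logic of the world `J`, where `w` stands for it. -/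
def BTy.Cross {S : Sig.{u}} (M : PolicyModule S) (o : S.User) :
    BTy S → ℕ → Interp S → Interp S → Val S → Val S → Prop
  | .bool, _, _, _, v, w => w = v ∧ ∃ b, v = .const (.bool b)
  | .str, _, _, _, v, w => w = v ∧ ∃ b, v = .const (.str b)
  | .user, _, _, _, v, w => w = v ∧ ∃ a, v = .const (.user a)
  | .tag T π, k, I, J, v, w => T.HasSort w ∧ T.Valid M k I v ∧
      (π I I.mem o → ∃ c, Ty.Cross M o T k I J v c)
  | .ref T, _, I, J, v, w => w = v ∧ ∃ l, v = .const (.loc l) ∧ T.at I = M.locTy l ∧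
      T.at J = M.locTy l

/-- The analogue of `BTy.Cross` for types. -/
def Ty.Cross {S : Sig.{u}} (M : PolicyModule S) (o : S.User) :
    Ty S → ℕ → Interp S → Interp S → Val S → Val S → Prop
  | .sc B r, k, I, J, v, w => BTy.Cross M o B k I J v w ∧ r I v ∧ r J w
  | .fn Tx T, k, I, J, f, g => (Ty.fn Tx T).Valid M k I f ∧ (Ty.fn Tx T).HasSort g ∧
      ∀ j ≤ k, ∀ a b, Ty.Cross M o Tx j I J a b →
        ∀ v j', Ev M I.mem j (.app f.toExpr a.toExpr) v j' →
          ∃ w, Ty.Cross M o T j' (I.push a) (J.push b) v w ∧ (f.IsConst → w = v)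

end

/-! ### Values of two runs -/

mutual

/-- Runs in the worlds `I` and `J` may compute `v` and `w` for the same expression: what the
observer `o` can see in both worlds agrees. -/
def BTy.Agree {S : Sig.{u}} (M : PolicyModule S) (o : S.User) :
    BTy S → ℕ → ℕ → Interp S → Interp S → Val S → Val S → Prop
  | .bool, _, _, _, _, v, w => w = v ∧ ∃ b, v = .const (.bool b)
  | .str, _, _, _, _, v, w => w = v ∧ ∃ b, v = .const (.str b)
  | .user, _, _, _, _, v, w => w = v ∧ ∃ a, v = .const (.user a)
  | .tag T π, k, m, I, J, v, w => T.Valid M k I v ∧ T.Valid M m J w ∧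
      (π I I.mem o → ∃ c, T.Cross M o k I J v c) ∧
      (π J J.mem o → ∃ c, T.Cross M o m J I w c) ∧
      (π I I.mem o → π J J.mem o → Ty.Agree M o T k m I J v w)
  | .ref T, _, _, I, J, v, w => w = v ∧ ∃ l, v = .const (.loc l) ∧ T.at I = M.locTy l ∧
      T.at J = M.locTy l

/-- The analogue of `BTy.Agree` for types. -/
def Ty.Agree {S : Sig.{u}} (M : PolicyModule S) (o : S.User) :
    Ty S → ℕ → ℕ → Interp S → Interp S → Val S → Val S → Prop
  | .sc B r, k, m, I, J, v, w => BTy.Agree M o B k m I J v w ∧ r I v ∧ r J w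
  | .fn Tx T, k, m, I, J, f, g => (Ty.fn Tx T).Cross M o k I J f g ∧
      (Ty.fn Tx T).Cross M o m J I g f ∧
      ∀ j ≤ k, ∀ i ≤ m, ∀ a b, Ty.Agree M o Tx j i I J a b →
        ∀ v j', Ev M I.mem j (.app f.toExpr a.toExpr) v j' →
        ∀ w i', Ev M J.mem i (.app g.toExpr b.toExpr) w i' →
          Ty.Agree M o T j' i' (I.push a) (J.push b) v w

end

section Relations

variable {S : Sig.{u}} {M : PolicyModule S} {o : S.User}

mutual

theorem BTy.Valid.hasSort : ∀ {B : BTy S} {k : ℕ} {I : Interp S} {v : Val S},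
    B.Valid M k I v → B.HasSort v
  | .bool, _, _, _, h => h
  | .str, _, _, _, h => h
  | .user, _, _, _, h => h
  | .tag _ _, _, _, _, h => Ty.Valid.hasSort h
  | .ref _, _, _, _, ⟨l, h, _⟩ => ⟨l, h⟩

theorem Ty.Valid.hasSort : ∀ {T : Ty S} {k : ℕ} {I : Interp S} {v : Val S},
    T.Valid M k I v → T.HasSort v
  | .sc _ _, _, _, _, h => BTy.Valid.hasSort h.1
  | .fn _ _, _, _, _, h => h.1

end

theorem Ty.Valid.holds {T : Ty S} {k : ℕ} {I : Interp S} {v : Val S} (h : T.Valid M k I v) :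
    T.Holds I v := by
  cases T with
  | sc B r => exact ⟨h.1.hasSort, h.2⟩
  | fn => exact h.1

mutual

theorem BTy.Valid.mono : ∀ {B : BTy S} {k j : ℕ} {I : Interp S} {v : Val S}, j ≤ k →
    B.Valid M k I v → B.Valid M j I v
  | .bool, _, _, _, _, _, h => h
  | .str, _, _, _, _, _, h => h
  | .user, _, _, _, _, _, h => h
  | .tag _ _, _, _, _, _, hj, h => Ty.Valid.mono hj h
  | .ref _, _, _, _, _, _, h => h

theorem Ty.Valid.mono : ∀ {T : Ty S} {k j : ℕ} {I : Interp S} {v : Val S}, j ≤ k →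
    T.Valid M k I v → T.Valid M j I v
  | .sc _ _, _, _, _, _, hj, h => ⟨BTy.Valid.mono hj h.1, h.2⟩
  | .fn _ _, _, _, _, _, hj, h => ⟨h.1, h.2.1, fun i hi => h.2.2 i (hi.trans hj)⟩

end

theorem Ty.Cross.valid {T : Ty S} {k : ℕ} {I J : Interp S} {v w : Val S}
    (h : T.Cross M o k I J v w) : T.Valid M k I v := by
  cases T with
  | sc B r =>
    refine ⟨?_, h.2.1⟩
    cases B with
    | bool => exact h.1.2
    | str => exact h.1.2
    | user => exact h.1.2
    | tag => exact h.1.2.1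
    | ref =>
      obtain ⟨_, l, h₁, h₂, _⟩ := h.1
      exact ⟨l, h₁, h₂⟩
  | fn => exact h.1

theorem Ty.Cross.holds {T : Ty S} {k : ℕ} {I J : Interp S} {v w : Val S}
    (h : T.Cross M o k I J v w) : T.Holds J w := by
  cases T with
  | sc B r =>
    refine ⟨?_, h.2.2⟩
    cases B with
    | bool => obtain ⟨rfl, h⟩ := h.1; exact h
    | str => obtain ⟨rfl, h⟩ := h.1; exact h
    | user => obtain ⟨rfl, h⟩ := h.1; exact h
    | tag => exact h.1.1
    | ref => obtain ⟨⟨rfl, l, h, _⟩, _⟩ := h; exact ⟨l, h⟩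
  | fn => exact h.2.1

theorem Ty.Holds.hasSort {T : Ty S} {I : Interp S} {v : Val S} (h : T.Holds I v) :
    T.HasSort v := by
  cases T with
  | sc B r => exact h.1
  | fn => exact h

mutual

theorem BTy.Cross.mono : ∀ {B : BTy S} {k j : ℕ} {I J : Interp S} {v w : Val S}, j ≤ k →
    B.Cross M o k I J v w → B.Cross M o j I J v w
  | .bool, _, _, _, _, _, _, _, h => h
  | .str, _, _, _, _, _, _, _, h => h
  | .user, _, _, _, _, _, _, _, h => h
  | .tag _ _, _, _, _, _, _, _, hj, h => ⟨h.1, h.2.1.mono hj, fun hπ =>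
      (h.2.2 hπ).imp fun _ h => Ty.Cross.mono hj h⟩
  | .ref _, _, _, _, _, _, _, _, h => h

theorem Ty.Cross.mono : ∀ {T : Ty S} {k j : ℕ} {I J : Interp S} {v w : Val S}, j ≤ k →
    T.Cross M o k I J v w → T.Cross M o j I J v w
  | .sc _ _, _, _, _, _, _, _, hj, h => ⟨BTy.Cross.mono hj h.1, h.2⟩
  | .fn _ _, _, _, _, _, _, _, hj, h =>
      ⟨h.1.mono hj, h.2.1, fun i hi => h.2.2 i (hi.trans hj)⟩

end

theorem Ty.Agree.cross {T : Ty S} {k m : ℕ} {I J : Interp S} {v w : Val S}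
    (h : T.Agree M o k m I J v w) : T.Cross M o k I J v w := by
  cases T with
  | sc B r =>
    refine ⟨?_, h.2⟩
    cases B with
    | bool => exact h.1
    | str => exact h.1
    | user => exact h.1
    | tag => exact ⟨h.1.2.1.hasSort, h.1.1, h.1.2.2.1⟩
    | ref => exact h.1
  | fn => exact h.1

theorem Ty.Agree.cross_symm {T : Ty S} {k m : ℕ} {I J : Interp S} {v w : Val S}
    (h : T.Agree M o k m I J v w) : T.Cross M o m J I w v := by
  cases T with
  | sc B r =>
    refine ⟨?_, h.2.2, h.2.1⟩
    cases B with
    | bool => obtain ⟨rfl, h⟩ := h.1; exact ⟨rfl, h⟩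
    | str => obtain ⟨rfl, h⟩ := h.1; exact ⟨rfl, h⟩
    | user => obtain ⟨rfl, h⟩ := h.1; exact ⟨rfl, h⟩
    | tag => exact ⟨h.1.1.hasSort, h.1.2.1, h.1.2.2.2.1⟩
    | ref => obtain ⟨⟨rfl, l, h₁, h₂, h₃⟩, _⟩ := h; exact ⟨rfl, l, h₁, h₃, h₂⟩
  | fn => exact h.2.1

mutual

theorem BTy.Agree.mono : ∀ {B : BTy S} {k m j i : ℕ} {I J : Interp S} {v w : Val S}, j ≤ k →
    i ≤ m → B.Agree M o k m I J v w → B.Agree M o j i I J v w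
  | .bool, _, _, _, _, _, _, _, _, _, _, h => h
  | .str, _, _, _, _, _, _, _, _, _, _, h => h
  | .user, _, _, _, _, _, _, _, _, _, _, h => h
  | .tag _ _, _, _, _, _, _, _, _, _, hj, hi, h => ⟨h.1.mono hj, h.2.1.mono hi,
      fun hπ => (h.2.2.1 hπ).imp fun _ h => h.mono hj,
      fun hπ => (h.2.2.2.1 hπ).imp fun _ h => h.mono hi,
      fun hπ hπ' => Ty.Agree.mono hj hi (h.2.2.2.2 hπ hπ')⟩
  | .ref _, _, _, _, _, _, _, _, _, _, _, h => h

theorem Ty.Agree.mono : ∀ {T : Ty S} {k m j i : ℕ} {I J : Interp S} {v w : Val S}, j ≤ k →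
    i ≤ m → T.Agree M o k m I J v w → T.Agree M o j i I J v w
  | .sc _ _, _, _, _, _, _, _, _, _, hj, hi, h => ⟨BTy.Agree.mono hj hi h.1, h.2⟩
  | .fn _ _, _, _, _, _, _, _, _, _, hj, hi, h =>
      ⟨h.1.mono hj, h.2.1.mono hi, fun j' hj' i' hi' =>
        h.2.2 j' (hj'.trans hj) i' (hi'.trans hi)⟩

end

/-! ### The relations depend on instances of types only -/

mutual

theorem BTy.valid_congr : ∀ {B B' : BTy S} {I I' : Interp S}, B.at I = B'.at I' →
    I.mem = I'.mem → ∀ k v, B.Valid M k I v ↔ B'.Valid M k I' v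
  | .bool, B', I, I', h, _, _, _ => by
    cases B' <;> simp only [BTy.at, BTy.map, reduceCtorEq] at h; rfl
  | .str, B', I, I', h, _, _, _ => by
    cases B' <;> simp only [BTy.at, BTy.map, reduceCtorEq] at h; rfl
  | .user, B', I, I', h, _, _, _ => by
    cases B' <;> simp only [BTy.at, BTy.map, reduceCtorEq] at h; rfl
  | .tag T π, B', I, I', h, hm, k, v => by
    cases B' with
    | tag T' π' => exact Ty.valid_congr (BTy.at_tag h).1 hm k v
    | _ => simp only [BTy.at, BTy.map, reduceCtorEq] at h
  | .ref T, B', I, I', h, _, _, _ => by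
    cases B' with
    | ref T' => simp only [BTy.Valid, BTy.at_ref h]
    | _ => simp only [BTy.at, BTy.map, reduceCtorEq] at h

theorem Ty.valid_congr : ∀ {T T' : Ty S} {I I' : Interp S}, T.at I = T'.at I' →
    I.mem = I'.mem → ∀ k v, T.Valid M k I v ↔ T'.Valid M k I' v
  | .sc B r, T', I, I', h, hm, k, v => by
    cases T' with
    | sc B' r' =>
      simp only [Ty.Valid, BTy.valid_congr (Ty.at_sc h).1 hm k v, (Ty.at_sc h).2]
    | fn => simp only [Ty.at, Ty.map, reduceCtorEq] at h
  | .fn Tx T, T', I, I', h, hm, k, v => by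
    cases T' with
    | sc => simp only [Ty.at, Ty.map, reduceCtorEq] at h
    | fn Tx' T' =>
      have hx := (Ty.at_fn h).1
      have ht := (Ty.at_fn h).2
      simp only [Ty.Valid, Ty.isPrim_congr hx, Ty.hasSort_congr h, hm, Ty.valid_congr hx hm]
      have ht' : ∀ a k v, T.Valid M k (I.push a) v ↔ T'.Valid M k (I'.push a) v :=
        fun a => Ty.valid_congr (ht a) hm
      simp only [ht']

end

mutual

theorem BTy.cross_congr : ∀ {B B' : BTy S} {I I' J J' : Interp S}, B.at I = B'.at I' →
    B.at J = B'.at J' → I.mem = I'.mem →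
    ∀ k v w, B.Cross M o k I J v w ↔ B'.Cross M o k I' J' v w
  | .bool, B', I, I', _, _, h, _, _, _, _, _ => by
    cases B' <;> simp only [BTy.at, BTy.map, reduceCtorEq] at h; rfl
  | .str, B', I, I', _, _, h, _, _, _, _, _ => by
    cases B' <;> simp only [BTy.at, BTy.map, reduceCtorEq] at h; rfl
  | .user, B', I, I', _, _, h, _, _, _, _, _ => by
    cases B' <;> simp only [BTy.at, BTy.map, reduceCtorEq] at h; rfl
  | .tag T π, B', I, I', J, J', h, h', hm, k, v, w => by
    cases B' with
    | tag T' π' =>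
      have ht := (BTy.at_tag h).1
      simp only [BTy.Cross, Ty.hasSort_congr ht, Ty.valid_congr ht hm, (BTy.at_tag h).2, hm,
        Ty.cross_congr ht (BTy.at_tag h').1 hm]
    | _ => simp only [BTy.at, BTy.map, reduceCtorEq] at h
  | .ref T, B', I, I', J, J', h, h', _, _, _, _ => by
    cases B' with
    | ref T' => simp only [BTy.Cross, BTy.at_ref h, BTy.at_ref h']
    | _ => simp only [BTy.at, BTy.map, reduceCtorEq] at h

theorem Ty.cross_congr : ∀ {T T' : Ty S} {I I' J J' : Interp S}, T.at I = T'.at I' →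
    T.at J = T'.at J' → I.mem = I'.mem →
    ∀ k v w, T.Cross M o k I J v w ↔ T'.Cross M o k I' J' v w
  | .sc B r, T', I, I', J, J', h, h', hm, k, v, w => by
    cases T' with
    | sc B' r' =>
      simp only [Ty.Cross, BTy.cross_congr (Ty.at_sc h).1 (Ty.at_sc h').1 hm k v w,
        (Ty.at_sc h).2, (Ty.at_sc h').2]
    | fn => simp only [Ty.at, Ty.map, reduceCtorEq] at h
  | .fn Tx T, T', I, I', J, J', h, h', hm, k, v, w => by
    cases T' with
    | sc => simp only [Ty.at, Ty.map, reduceCtorEq] at h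
    | fn Tx' T' =>
      have hx := (Ty.at_fn h).1
      have ht := (Ty.at_fn h).2
      simp only [Ty.Cross, Ty.valid_congr h hm, Ty.hasSort_congr h, hm,
        Ty.cross_congr hx (Ty.at_fn h').1 hm]
      have ht' : ∀ a b k v w, T.Cross M o k (I.push a) (J.push b) v w ↔
          T'.Cross M o k (I'.push a) (J'.push b) v w :=
        fun a b => Ty.cross_congr (ht a) ((Ty.at_fn h').2 b) hm
      simp only [ht']

end

mutual

theorem BTy.agree_congr : ∀ {B B' : BTy S} {I I' J J' : Interp S}, B.at I = B'.at I' →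
    B.at J = B'.at J' → I.mem = I'.mem → J.mem = J'.mem →
    ∀ k m v w, B.Agree M o k m I J v w ↔ B'.Agree M o k m I' J' v w
  | .bool, B', I, I', _, _, h, _, _, _, _, _, _, _ => by
    cases B' <;> simp only [BTy.at, BTy.map, reduceCtorEq] at h; rfl
  | .str, B', I, I', _, _, h, _, _, _, _, _, _, _ => by
    cases B' <;> simp only [BTy.at, BTy.map, reduceCtorEq] at h; rfl
  | .user, B', I, I', _, _, h, _, _, _, _, _, _, _ => by
    cases B' <;> simp only [BTy.at, BTy.map, reduceCtorEq] at h; rfl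
  | .tag T π, B', I, I', J, J', h, h', hm, hm', k, m, v, w => by
    cases B' with
    | tag T' π' =>
      have ht := (BTy.at_tag h).1
      have ht' := (BTy.at_tag h').1
      simp only [BTy.Agree, Ty.valid_congr ht hm, Ty.valid_congr ht' hm', (BTy.at_tag h).2, hm,
        (BTy.at_tag h').2, hm', Ty.cross_congr ht ht' hm, Ty.cross_congr ht' ht hm',
        Ty.agree_congr ht ht' hm hm']
    | _ => simp only [BTy.at, BTy.map, reduceCtorEq] at h
  | .ref T, B', I, I', J, J', h, h', _, _, _, _, _, _ => by
    cases B' with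
    | ref T' => simp only [BTy.Agree, BTy.at_ref h, BTy.at_ref h']
    | _ => simp only [BTy.at, BTy.map, reduceCtorEq] at h

theorem Ty.agree_congr : ∀ {T T' : Ty S} {I I' J J' : Interp S}, T.at I = T'.at I' →
    T.at J = T'.at J' → I.mem = I'.mem → J.mem = J'.mem →
    ∀ k m v w, T.Agree M o k m I J v w ↔ T'.Agree M o k m I' J' v w
  | .sc B r, T', I, I', J, J', h, h', hm, hm', k, m, v, w => by
    cases T' with
    | sc B' r' =>
      simp only [Ty.Agree, BTy.agree_congr (Ty.at_sc h).1 (Ty.at_sc h').1 hm hm' k m v w,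
        (Ty.at_sc h).2, (Ty.at_sc h').2]
    | fn => simp only [Ty.at, Ty.map, reduceCtorEq] at h
  | .fn Tx T, T', I, I', J, J', h, h', hm, hm', k, m, v, w => by
    cases T' with
    | sc => simp only [Ty.at, Ty.map, reduceCtorEq] at h
    | fn Tx' T' =>
      simp only [Ty.Agree, Ty.cross_congr h h' hm, Ty.cross_congr h' h hm', hm, hm',
        Ty.agree_congr (Ty.at_fn h).1 (Ty.at_fn h').1 hm hm']
      have ht' : ∀ a b k m v w, T.Agree M o k m (I.push a) (J.push b) v w ↔
          T'.Agree M o k m (I'.push a) (J'.push b) v w :=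
        fun a b => Ty.agree_congr ((Ty.at_fn h).2 a) ((Ty.at_fn h').2 b) hm hm'
      simp only [ht']

end

theorem Ty.valid_weaken {T : Ty S} {k : ℕ} {I : Interp S} {a v : Val S} :
    T.weaken.Valid M k (I.push a) v ↔ T.Valid M k I v :=
  Ty.valid_congr (T.at_weaken I a) rfl k v

theorem Ty.cross_weaken {T : Ty S} {k : ℕ} {I J : Interp S} {a b v w : Val S} :
    T.weaken.Cross M o k (I.push a) (J.push b) v w ↔ T.Cross M o k I J v w :=
  Ty.cross_congr (T.at_weaken I a) (T.at_weaken J b) rfl k v w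

theorem Ty.agree_weaken {T : Ty S} {k m : ℕ} {I J : Interp S} {a b v w : Val S} :
    T.weaken.Agree M o k m (I.push a) (J.push b) v w ↔ T.Agree M o k m I J v w :=
  Ty.agree_congr (T.at_weaken I a) (T.at_weaken J b) rfl rfl k m v w

theorem Ty.valid_subst {T : Ty S} {t : Interp S → Val S} {k : ℕ} {I : Interp S} {v : Val S} :
    (T.subst t).Valid M k I v ↔ T.Valid M k (I.push (t I)) v :=
  Ty.valid_congr (T.at_subst t I) rfl k v

theorem Ty.cross_subst {T : Ty S} {t : Interp S → Val S} {k : ℕ} {I J : Interp S}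
    {v w : Val S} :
    (T.subst t).Cross M o k I J v w ↔ T.Cross M o k (I.push (t I)) (J.push (t J)) v w :=
  Ty.cross_congr (T.at_subst t I) (T.at_subst t J) rfl k v w

theorem Ty.agree_subst {T : Ty S} {t : Interp S → Val S} {k m : ℕ} {I J : Interp S}
    {v w : Val S} :
    (T.subst t).Agree M o k m I J v w ↔ T.Agree M o k m (I.push (t I)) (J.push (t J)) v w :=
  Ty.agree_congr (T.at_subst t I) (T.at_subst t J) rfl rfl k m v w

end Relations

/-! ### Subtyping -/

section Subtyping

variable {S : Sig.{u}} {M : PolicyModule S} {o : S.User}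

mutual

theorem SubtyB.hasSort {v : Val S} : ∀ {Γ : TEnv S} {B B' : BTy S}, SubtyB M Γ B B' →
    B.HasSort v → B'.HasSort v
  | _, _, _, .refl _ _, h => h
  | _, _, _, .tag hT _, h => Subty.hasSort hT h

theorem Subty.hasSort {v : Val S} : ∀ {Γ : TEnv S} {T T' : Ty S}, Subty M Γ T T' →
    T.HasSort v → T'.HasSort v
  | _, _, _, .sc hB _, h => SubtyB.hasSort hB h
  | _, _, _, .fn _ _, h => h
  | _, _, _, .tagTop _ _, h => h

end

theorem Subty.isPrim {Γ : TEnv S} {T T' : Ty S} (h : Subty M Γ T T') (h' : T'.IsPrim) :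
    T.IsPrim := by
  cases h with
  | sc hB _ =>
    cases hB with
    | refl => exact h'
    | tag => cases h'
  | fn => exact h'
  | tagTop => cases h'

theorem PolicyModule.Sat.push {Γ : TEnv S} {T : Ty S} {I : Interp S} {v : Val S}
    (h : M.Sat Γ I) (hv : T.Holds I v) : M.Sat (.bind T :: Γ) (I.push v) := ⟨h, hv⟩

theorem PolicyModule.Sat.sorted : ∀ {Γ : TEnv S} {I : Interp S}, M.Sat Γ I → M.Sorted I.mem
  | [], _, h => h
  | .bind _ :: _, I, h => PolicyModule.Sat.sorted (I := I.pop) h.1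
  | .cond _ :: _, _, h => PolicyModule.Sat.sorted h.1

mutual

theorem SubtyB.valid : ∀ {Γ : TEnv S} {B B' : BTy S}, SubtyB M Γ B B' →
    ∀ {k : ℕ} {I : Interp S} {v : Val S}, M.Sat Γ I → B.Valid M k I v → B'.Valid M k I v
  | _, _, _, .refl _ _, _, _, _, _, h => h
  | _, _, _, .tag hT _, _, _, _, hI, h => Subty.valid hT hI h

theorem Subty.valid : ∀ {Γ : TEnv S} {T T' : Ty S}, Subty M Γ T T' →
    ∀ {k : ℕ} {I : Interp S} {v : Val S}, M.Sat Γ I → T.Valid M k I v → T'.Valid M k I v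
  | _, _, _, .sc hB hr, _, _, _, hI, h =>
    ⟨SubtyB.valid hB hI h.1, hr _ hI _ h.1.hasSort h.2⟩
  | _, _, _, .fn hx hT, _, _, _, hI, h =>
    ⟨h.1, fun hf => hx.isPrim (h.2.1 hf), fun j hj a ha v j' he =>
      Subty.valid hT (hI.push ha.holds) (h.2.2 j hj a (Subty.valid hx hI ha) v j' he)⟩
  | _, _, _, .tagTop _ _, _, _, _, _, h => ⟨h, trivial⟩

end

mutual

theorem SubtyB.cross : ∀ {Γ : TEnv S} {B B' : BTy S}, SubtyB M Γ B B' →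
    ∀ {k : ℕ} {I J : Interp S} {v w : Val S}, M.Sat Γ I → M.Sat Γ J →
      B.Cross M o k I J v w → B'.Cross M o k I J v w
  | _, _, _, .refl _ _, _, _, _, _, _, _, _, h => h
  | _, _, _, .tag hT hπ, _, I, _, _, _, hI, hJ, h =>
    ⟨hT.hasSort h.1, hT.valid hI h.2.1, fun hv =>
      (h.2.2 (hπ I hI _ _ hI.sorted hv)).imp fun _ hc => Subty.cross hT hI hJ hc⟩

theorem Subty.cross : ∀ {Γ : TEnv S} {T T' : Ty S}, Subty M Γ T T' →
    ∀ {k : ℕ} {I J : Interp S} {v w : Val S}, M.Sat Γ I → M.Sat Γ J →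
      T.Cross M o k I J v w → T'.Cross M o k I J v w
  | _, _, _, .sc hB hr, _, _, _, _, _, hI, hJ, h =>
    ⟨SubtyB.cross hB hI hJ h.1, hr _ hI _ h.valid.holds.1 h.2.1, hr _ hJ _ h.holds.1 h.2.2⟩
  | _, _, _, .fn hx hT, _, _, _, _, _, hI, hJ, h =>
    ⟨(Subty.fn hx hT).valid hI h.1, h.2.1, fun j hj a b hab v j' he => by
      obtain ⟨w, hw, hc⟩ := h.2.2 j hj a b (Subty.cross hx hI hJ hab) v j' he
      exact ⟨w, Subty.cross hT (hI.push hab.valid.holds) (hJ.push hab.holds) hw, hc⟩⟩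
  | _, _, _, .tagTop _ _, _, _, _, _, w, _, _, h =>
    ⟨⟨h.holds.hasSort, h.valid, fun _ => ⟨w, h⟩⟩, trivial, trivial⟩

end

mutual

theorem SubtyB.agree : ∀ {Γ : TEnv S} {B B' : BTy S}, SubtyB M Γ B B' →
    ∀ {k m : ℕ} {I J : Interp S} {v w : Val S}, M.Sat Γ I → M.Sat Γ J →
      B.Agree M o k m I J v w → B'.Agree M o k m I J v w
  | _, _, _, .refl _ _, _, _, _, _, _, _, _, _, h => h
  | _, _, _, .tag hT hπ, _, _, I, J, _, _, hI, hJ, h =>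
    ⟨hT.valid hI h.1, hT.valid hJ h.2.1,
      fun hv => (h.2.2.1 (hπ I hI _ _ hI.sorted hv)).imp fun _ hc => hT.cross hI hJ hc,
      fun hv => (h.2.2.2.1 (hπ J hJ _ _ hJ.sorted hv)).imp fun _ hc => hT.cross hJ hI hc,
      fun hv hw => Subty.agree hT hI hJ
        (h.2.2.2.2 (hπ I hI _ _ hI.sorted hv) (hπ J hJ _ _ hJ.sorted hw))⟩

theorem Subty.agree : ∀ {Γ : TEnv S} {T T' : Ty S}, Subty M Γ T T' →
    ∀ {k m : ℕ} {I J : Interp S} {v w : Val S}, M.Sat Γ I → M.Sat Γ J →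
      T.Agree M o k m I J v w → T'.Agree M o k m I J v w
  | _, _, _, .sc hB hr, _, _, _, _, _, _, hI, hJ, h =>
    ⟨SubtyB.agree hB hI hJ h.1, hr _ hI _ h.cross.valid.holds.1 h.2.1,
      hr _ hJ _ h.cross.holds.1 h.2.2⟩
  | _, _, _, .fn hx hT, _, _, _, _, _, _, hI, hJ, h =>
    ⟨(Subty.fn hx hT).cross hI hJ h.1, (Subty.fn hx hT).cross hJ hI h.2.1,
      fun j hj i hi a b hab v j' he w i' he' =>
        Subty.agree hT (hI.push hab.cross.valid.holds) (hJ.push hab.cross.holds)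
          (h.2.2 j hj i hi a b (Subty.agree hx hI hJ hab) v j' he w i' he')⟩
  | _, _, _, .tagTop _ _, _, _, _, _, v, w, _, _, h =>
    ⟨⟨h.cross.valid, h.cross_symm.valid, fun _ => ⟨w, h.cross⟩, fun _ => ⟨v, h.cross_symm⟩,
      fun _ _ => h⟩, trivial, trivial⟩

end

end Subtyping

/-! ### Environments -/

/-- All variables have valid values. -/
structure PolicyModule.ValidEnv {S : Sig.{u}} (M : PolicyModule S) (Γ : TEnv S) (k : ℕ)
    (I : Interp S) : Prop where
  sat : M.Sat Γ I
  lookup : ∀ {i T}, Lookup Γ i T → T.Valid M k I (I.env i)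

/-- The values of all variables in `I` make sense in `J`. -/
structure PolicyModule.CrossEnv {S : Sig.{u}} (M : PolicyModule S) (o : S.User) (Γ : TEnv S)
    (k : ℕ) (I J : Interp S) : Prop where
  valid : M.ValidEnv Γ k I
  sat : M.Sat Γ J
  lookup : ∀ {i T}, Lookup Γ i T → T.Cross M o k I J (I.env i) (J.env i)

/-- The values of all variables agree. -/
structure PolicyModule.AgreeEnv {S : Sig.{u}} (M : PolicyModule S) (o : S.User) (Γ : TEnv S)
    (k m : ℕ) (I J : Interp S) : Prop where
  cross : M.CrossEnv o Γ k I J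
  cross_symm : M.CrossEnv o Γ m J I
  lookup : ∀ {i T}, Lookup Γ i T → T.Agree M o k m I J (I.env i) (J.env i)

section Environments

variable {S : Sig.{u}} {M : PolicyModule S} {o : S.User} {Γ : TEnv S}

theorem PolicyModule.ValidEnv.mono {k j : ℕ} {I : Interp S} (h : M.ValidEnv Γ k I)
    (hj : j ≤ k) : M.ValidEnv Γ j I := ⟨h.sat, fun hl => (h.lookup hl).mono hj⟩

theorem PolicyModule.ValidEnv.push {k : ℕ} {I : Interp S} (h : M.ValidEnv Γ k I) {T : Ty S}
    {v : Val S} (hv : T.Valid M k I v) : M.ValidEnv (.bind T :: Γ) k (I.push v) := by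
  refine ⟨h.sat.push hv.holds, fun hl => ?_⟩
  cases hl with
  | here => exact Ty.valid_weaken.2 hv
  | there _ hl => exact Ty.valid_weaken.2 (h.lookup hl)

theorem PolicyModule.ValidEnv.cond {k : ℕ} {I : Interp S} (h : M.ValidEnv Γ k I) {p : Cond S}
    (hp : p I) : M.ValidEnv (.cond p :: Γ) k I := by
  refine ⟨⟨h.sat, hp⟩, fun hl => ?_⟩
  cases hl with
  | skip _ hl => exact h.lookup hl

theorem PolicyModule.ValidEnv.nil {k : ℕ} {I : Interp S} (h : M.Sorted I.mem) :
    M.ValidEnv [] k I := ⟨h, nofun⟩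

theorem PolicyModule.CrossEnv.mono {k j : ℕ} {I J : Interp S} (h : M.CrossEnv o Γ k I J)
    (hj : j ≤ k) : M.CrossEnv o Γ j I J :=
  ⟨h.valid.mono hj, h.sat, fun hl => (h.lookup hl).mono hj⟩

theorem PolicyModule.CrossEnv.push {k : ℕ} {I J : Interp S} (h : M.CrossEnv o Γ k I J)
    {T : Ty S} {v w : Val S} (hv : T.Cross M o k I J v w) :
    M.CrossEnv o (.bind T :: Γ) k (I.push v) (J.push w) := by
  refine ⟨h.valid.push hv.valid, h.sat.push hv.holds, fun hl => ?_⟩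
  cases hl with
  | here => exact Ty.cross_weaken.2 hv
  | there _ hl => exact Ty.cross_weaken.2 (h.lookup hl)

theorem PolicyModule.CrossEnv.cond {k : ℕ} {I J : Interp S} (h : M.CrossEnv o Γ k I J)
    {p : Cond S} (hp : p I) (hp' : p J) : M.CrossEnv o (.cond p :: Γ) k I J := by
  refine ⟨h.valid.cond hp, ⟨h.sat, hp'⟩, fun hl => ?_⟩
  cases hl with
  | skip _ hl => exact h.lookup hl

theorem PolicyModule.CrossEnv.nil {k : ℕ} {I J : Interp S} (h : M.Sorted I.mem)
    (h' : M.Sorted J.mem) : M.CrossEnv o [] k I J := ⟨.nil h, h', nofun⟩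

theorem PolicyModule.AgreeEnv.mono {k m j i : ℕ} {I J : Interp S}
    (h : M.AgreeEnv o Γ k m I J) (hj : j ≤ k) (hi : i ≤ m) : M.AgreeEnv o Γ j i I J :=
  ⟨h.cross.mono hj, h.cross_symm.mono hi, fun hl => (h.lookup hl).mono hj hi⟩

theorem PolicyModule.AgreeEnv.push {k m : ℕ} {I J : Interp S} (h : M.AgreeEnv o Γ k m I J)
    {T : Ty S} {v w : Val S} (hv : T.Agree M o k m I J v w) :
    M.AgreeEnv o (.bind T :: Γ) k m (I.push v) (J.push w) := by
  refine ⟨h.cross.push hv.cross, h.cross_symm.push hv.cross_symm, fun hl => ?_⟩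
  cases hl with
  | here => exact Ty.agree_weaken.2 hv
  | there _ hl => exact Ty.agree_weaken.2 (h.lookup hl)

theorem PolicyModule.AgreeEnv.cond {k m : ℕ} {I J : Interp S} (h : M.AgreeEnv o Γ k m I J)
    {p : Cond S} (hp : p I) (hp' : p J) : M.AgreeEnv o (.cond p :: Γ) k m I J := by
  refine ⟨h.cross.cond hp hp', h.cross_symm.cond hp' hp, fun hl => ?_⟩
  cases hl with
  | skip _ hl => exact h.lookup hl

theorem PolicyModule.AgreeEnv.nil {k m : ℕ} {I J : Interp S} (h : M.Sorted I.mem)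
    (h' : M.Sorted J.mem) : M.AgreeEnv o [] k m I J := ⟨.nil h h', .nil h' h, nofun⟩

end Environments

/-! ### Evaluation of closed instances -/

/-- The instance of an expression in which the variables have the values that `I` gives them. -/
def Expr.close {S : Sig.{u}} (e : Expr S) (I : Interp S) : Expr S :=
  e.subst fun i => (I.env i).toExpr

section Closing

variable {S : Sig.{u}} {M : PolicyModule S} {σ : Mem S}

theorem consVar_env (I : Interp S) (a : Val S) :
    consVar a.toExpr (fun i => (I.env i).toExpr) = fun i => ((I.push a).env i).toExpr := by
  funext i
  cases i <;> rfl

theorem Ev.app_inv {k k' : ℕ} {e₁ e₂ : Expr S} {v : Val S} (h : Ev M σ k (.app e₁ e₂) v k') :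
    ∃ f a k₁ k₂, Ev M σ k e₁ f k₁ ∧ Ev M σ k₁ e₂ a k₂ ∧
      Ev M σ k₂ (.app f.toExpr a.toExpr) v k' := by
  cases h with
  | beta h₁ h₂ h₃ => exact ⟨_, _, _, _, h₁, h₂, .beta (.val _ _) (.val _ _) h₃⟩
  | delta h₁ h₂ hd => exact ⟨_, _, _, _, h₁, h₂, .delta (.val _ _) (.val _ _) hd⟩

theorem Ev.bind_inv {k k' : ℕ} {e₁ e₂ : Expr S} {v : Val S}
    (h : Ev M σ k (.bind e₁ e₂) v k') :
    ∃ a f k₁ k₂, Ev M σ k e₁ a k₁ ∧ Ev M σ k₁ e₂ f k₂ ∧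
      Ev M σ k₂ (.app f.toExpr a.toExpr) v k' := by
  cases h with
  | bind h₁ h₂ h₃ => exact ⟨_, _, _, _, h₁, h₂, .beta (.val _ _) (.val _ _) h₃⟩

theorem Ev.lam_app_inv {I : Interp S} {k k' : ℕ} {e : Expr S} {a v : Val S}
    (h : Ev M σ k (.app ((Expr.lam e).close I) a.toExpr) v k') :
    Ev M σ k (e.close (I.push a)) v k' := by
  cases h with
  | beta h₁ h₂ h₃ =>
    cases h₁
    obtain ⟨rfl, rfl⟩ := h₂.of_val
    rw [Expr.inst, Expr.subst_liftSub_single, consVar_env] at h₃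
    exact h₃
  | delta h₁ => cases h₁

theorem Ev.const_app_inv {k k' : ℕ} {f : S.Fn} {c : Const S} {v : Val S}
    (h : Ev M σ k (.app (.const (.fn f)) (.const c)) v k') :
    k = k' + 1 ∧ ∃ d, M.delta f c = some d ∧ v = .const d := by
  cases h with
  | beta h₁ => cases h₁
  | delta h₁ h₂ hd => cases h₁; cases h₂; exact ⟨rfl, _, hd, rfl⟩

theorem Expr.ConstHead.eval {e : Expr S} (he : e.ConstHead) {I : Interp S} {k k' : ℕ}
    {v : Val S} (h : Ev M σ k (e.close I) v k') : v.IsConst := by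
  induction he generalizing k k' v with
  | const c => cases h; exact ⟨c, rfl⟩
  | app e₂ _ ih =>
    cases h with
    | beta h₁ => obtain ⟨c, hc⟩ := ih h₁; cases hc
    | delta => exact ⟨_, rfl⟩

theorem PolicyModule.Reflects.eval {e : Expr S} {t : Interp S → Val S} (ht : M.Reflects e t)
    {I : Interp S} {k k' : ℕ} {v : Val S} (h : Ev M σ k (e.close I) v k') : v = t I := by
  induction ht generalizing k k' v with
  | var i => exact h.of_val.1
  | const c => cases h; rfl
  | app hc _ _ ih₁ ih₂ =>
    cases h with
    | beta h₁ => obtain ⟨c, hc⟩ := hc.eval h₁; cases hc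
    | delta h₁ h₂ hd =>
      beta_reduce
      rw [← ih₁ h₁, ← ih₂ h₂]
      simp [PolicyModule.applyConst, hd]

theorem HasTy.close_eq {e : Expr S} {T : Ty S} (h : HasTy M [] e T) (I : Interp S) :
    e.close I = e := h.subst_eq_self _ nofun

end Closing

/-- All locations hold values of their declared types. -/
def PolicyModule.MemTy {S : Sig.{u}} (M : PolicyModule S) (σ : Mem S) : Prop :=
  ∀ l, HasTy M [] (σ l).toExpr (M.locTy l)

section Constants

variable {S : Sig.{u}} {M : PolicyModule S} {o : S.User}

theorem PolicyModule.WellFormed.ty_hasSort (hM : M.WellFormed) (c : Const S) :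
    (M.ty c).HasSort (.const c) := by
  cases c with
  | bool b => exact ⟨b, rfl⟩
  | str w => exact ⟨w, rfl⟩
  | user a => exact ⟨a, rfl⟩
  | loc l => exact ⟨l, rfl⟩
  | fn f =>
    obtain ⟨B, r, T, _, hf, _⟩ := hM.fn_sound f
    simp only [PolicyModule.ty, hf]
    exact .inr ⟨f, rfl⟩

theorem HasTy.hasSort_val (hM : M.WellFormed) {Γ : TEnv S} {e : Expr S} {T : Ty S}
    (h : HasTy M Γ e T) {v : Val S} (hv : e = v.toExpr) : T.HasSort v := by
  induction h with
  | const _ c =>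
    obtain rfl : v = .const c := Val.toExpr_injective hv.symm
    exact hM.ty_hasSort c
  | @lam _ e =>
    obtain rfl : v = .lam e := Val.toExpr_injective hv.symm
    exact .inl ⟨e, rfl⟩
  | sub _ hs ih => exact hs.hasSort (ih hv)
  | _ => cases v <;> cases hv

theorem PolicyModule.MemTy.sorted (hM : M.WellFormed) {σ : Mem S} (h : M.MemTy σ) :
    M.Sorted σ := fun l => (h l).hasSort_val hM rfl

theorem PolicyModule.MemTy.noFree {σ : Mem S} (h : M.MemTy σ) : Mem.NoFree σ :=
  fun l θ => (h l).subst_eq_self θ nofun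

theorem BTy.IsPrim.valid_const {B : BTy S} (hB : B.IsPrim) {k : ℕ} {I : Interp S} {v : Val S}
    (h : B.Valid M k I v) : v.IsConst := by
  cases hB <;> obtain ⟨_, rfl⟩ := h <;> exact ⟨_, rfl⟩

theorem Ty.Cross.eq_of_isPrim {T : Ty S} (hT : T.IsPrim) {k : ℕ} {I J : Interp S}
    {v w : Val S} (h : T.Cross M o k I J v w) : w = v := by
  cases T with
  | sc B r =>
    cases hT <;> exact h.1.1
  | fn => cases hT

theorem PolicyModule.WellFormed.valid_const (hM : M.WellFormed) (k : ℕ) (c : Const S)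
    (I : Interp S) (hI : M.Sorted I.mem) : (M.ty c).Valid M k I (.const c) := by
  induction k using Nat.strong_induction_on generalizing c with
  | _ k ih =>
    cases c with
    | bool b => exact ⟨⟨b, rfl⟩, rfl⟩
    | str w => exact ⟨⟨w, rfl⟩, rfl⟩
    | user a => exact ⟨⟨a, rfl⟩, rfl⟩
    | loc l => exact ⟨⟨l, rfl, (hM.loc_closed l).at_eq I⟩, rfl⟩
    | fn f =>
      obtain ⟨B, r, T, hB, hf, hs⟩ := hM.fn_sound f
      simp only [PolicyModule.ty, hf]
      refine ⟨.inr ⟨f, rfl⟩, fun _ => hB, fun j hj a ha v j' he => ?_⟩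
      obtain ⟨c, rfl⟩ := hB.valid_const ha.1
      obtain ⟨rfl, d, hd, rfl⟩ := he.const_app_inv
      obtain ⟨d', hd', hsub⟩ := hs I c ha.1.hasSort ha.2
      obtain rfl : d = d' := Option.some_injective _ (hd.symm.trans hd')
      exact Ty.valid_subst.1 (hsub.valid hI (ih j' (by omega) d))

theorem PolicyModule.WellFormed.cross_const (hM : M.WellFormed) (k : ℕ) (c : Const S)
    (I J : Interp S) (hI : M.Sorted I.mem) (hJ : M.Sorted J.mem) :
    (M.ty c).Cross M o k I J (.const c) (.const c) := by
  induction k using Nat.strong_induction_on generalizing c with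
  | _ k ih =>
    cases c with
    | bool b => exact ⟨⟨rfl, b, rfl⟩, rfl, rfl⟩
    | str w => exact ⟨⟨rfl, w, rfl⟩, rfl, rfl⟩
    | user a => exact ⟨⟨rfl, a, rfl⟩, rfl, rfl⟩
    | loc l =>
      exact ⟨⟨rfl, l, rfl, (hM.loc_closed l).at_eq I, (hM.loc_closed l).at_eq J⟩, rfl, rfl⟩
    | fn f =>
      have hv := hM.valid_const k (.fn f) I hI
      obtain ⟨B, r, T, hB, hf, hs⟩ := hM.fn_sound f
      simp only [PolicyModule.ty, hf] at hv ⊢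
      refine ⟨hv, .inr ⟨f, rfl⟩, fun j hj a b hab v j' he => ?_⟩
      obtain rfl := Ty.Cross.eq_of_isPrim (T := .sc B r) hB hab
      obtain ⟨c, rfl⟩ := hB.valid_const hab.valid.1
      obtain ⟨rfl, d, hd, rfl⟩ := he.const_app_inv
      obtain ⟨d', hd', hsub⟩ := hs I c hab.valid.1.hasSort hab.valid.2
      obtain rfl : d = d' := Option.some_injective _ (hd.symm.trans hd')
      exact ⟨_, Ty.cross_subst.1 (hsub.cross hI hJ (ih j' (by omega) d)), fun _ => rfl⟩

theorem PolicyModule.WellFormed.agree_const (hM : M.WellFormed) (k m : ℕ) (c : Const S)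
    (I J : Interp S) (hI : M.Sorted I.mem) (hJ : M.Sorted J.mem) :
    (M.ty c).Agree M o k m I J (.const c) (.const c) := by
  induction k using Nat.strong_induction_on generalizing c m with
  | _ k ih =>
    cases c with
    | bool b => exact ⟨⟨rfl, b, rfl⟩, rfl, rfl⟩
    | str w => exact ⟨⟨rfl, w, rfl⟩, rfl, rfl⟩
    | user a => exact ⟨⟨rfl, a, rfl⟩, rfl, rfl⟩
    | loc l =>
      exact ⟨⟨rfl, l, rfl, (hM.loc_closed l).at_eq I, (hM.loc_closed l).at_eq J⟩, rfl, rfl⟩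
    | fn f =>
      have hv := hM.cross_const (o := o) k (.fn f) I J hI hJ
      have hv' := hM.cross_const (o := o) m (.fn f) J I hJ hI
      obtain ⟨B, r, T, hB, hf, hs⟩ := hM.fn_sound f
      simp only [PolicyModule.ty, hf] at hv hv' ⊢
      refine ⟨hv, hv', fun j hj i hi a b hab v j' he w i' he' => ?_⟩
      obtain rfl := Ty.Cross.eq_of_isPrim (T := .sc B r) hB hab.cross
      obtain ⟨c, rfl⟩ := hB.valid_const hab.cross.valid.1
      obtain ⟨rfl, d, hd, rfl⟩ := he.const_app_inv
      obtain ⟨rfl, d₁, hd₁, rfl⟩ := he'.const_app_inv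
      obtain ⟨d', hd', hsub⟩ := hs I c hab.cross.valid.1.hasSort hab.cross.valid.2
      obtain rfl : d = d' := Option.some_injective _ (hd.symm.trans hd')
      obtain rfl : d = d₁ := Option.some_injective _ (hd.symm.trans hd₁)
      exact Ty.agree_subst.1 (hsub.agree hI hJ (ih j' (by omega) i' d))

end Constants

/-! ### Soundness for a single run -/

theorem Val.not_isConst_lam {S : Sig.{u}} (e : Expr S) : ¬(Val.lam e).IsConst := nofun

section Fundamental

variable {S : Sig.{u}} {M : PolicyModule S} {o : S.User}

theorem HasTy.valid_of_store (hM : M.WellFormed) {σ : Mem S} {k : ℕ}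
    (hst : ∀ j < k, ∀ l (I : Interp S), I.mem = σ → (M.locTy l).Valid M j I (σ l))
    {Γ : TEnv S} {e : Expr S} {T : Ty S} (h : HasTy M Γ e T) {j j' : ℕ} (hj : j ≤ k)
    {I : Interp S} (hI : I.mem = σ) (hΓ : M.ValidEnv Γ j I) {v : Val S}
    (hv : Ev M σ j (e.close I) v j') : T.Valid M j' I v := by
  induction h generalizing j j' I v with
  | const Γ c =>
    cases hv
    exact hM.valid_const _ _ _ hΓ.sat.sorted
  | @var Γ i T hl =>
    obtain ⟨rfl, rfl⟩ := Ev.of_val (v := I.env i) hv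
    exact hΓ.lookup hl
  | @lam Γ e Tx T _ ih =>
    cases hv
    refine ⟨.inl ⟨_, rfl⟩, fun hc => absurd hc (Val.not_isConst_lam _), fun i hi a ha v i' he => ?_⟩
    rw [hI] at he
    exact ih (hi.trans hj) (I := I.push a) hI ((hΓ.mono hi).push ha) he.lam_app_inv
  | app _ _ ht ih₁ ih₂ =>
    obtain ⟨f, a, k₁, k₂, h₁, h₂, h₃⟩ := hv.app_inv
    have hf := ih₁ hj hI hΓ h₁
    have ha := ih₂ (h₁.le.trans hj) hI (hΓ.mono h₁.le) h₂
    obtain rfl := ht.eval h₂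
    exact Ty.valid_subst.2 (hf.2.2 _ h₂.le _ ha _ _ (by rwa [hI]))
  | appConst _ _ ih₁ ih₂ =>
    obtain ⟨f, a, k₁, k₂, h₁, h₂, h₃⟩ := hv.app_inv
    have hf := ih₁ hj hI hΓ h₁
    have ha := ih₂ (h₁.le.trans hj) hI (hΓ.mono h₁.le) h₂
    exact Ty.valid_weaken.1 (hf.2.2 _ h₂.le _ ha _ _ (by rwa [hI]))
  | @get Γ x B r t _ ht ih =>
    cases hv with
    | @get _ _ _ l h₁ =>
      obtain ⟨⟨_, hl, hT⟩, _⟩ := ih hj hI hΓ h₁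
      obtain ⟨rfl⟩ := hl
      have := (Ty.valid_congr (hT.trans ((hM.loc_closed l).at_eq I).symm) rfl _ _).2
        (hst j' (h₁.le.trans hj) l I hI)
      exact ⟨this.1, this.2, l, (ht.eval h₁).symm, by rw [hI]⟩
  | @getTag Γ x B r r' π t _ ht ih =>
    cases hv with
    | @get _ _ _ l h₁ =>
      obtain ⟨⟨_, hl, hT⟩, _⟩ := ih hj hI hΓ h₁
      obtain ⟨rfl⟩ := hl
      have := (Ty.valid_congr (hT.trans ((hM.loc_closed l).at_eq I).symm) rfl _ _).2
        (hst j' (h₁.le.trans hj) l I hI)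
      have hs : ∃ l', t I = .const (.loc l') ∧ σ l = I.mem l' :=
        ⟨l, (ht.eval h₁).symm, by rw [hI]⟩
      exact ⟨⟨this.1.1, this.1.2, hs⟩, this.2, hs⟩
  | ite _ _ _ ih ih₁ ih₂ =>
    cases hv with
    | iteTrue h₀ h₁ =>
      exact ih₁ (h₀.le.trans hj) hI ((hΓ.mono h₀.le).cond (ih hj hI hΓ h₀).2) h₁
    | iteFalse h₀ h₁ =>
      exact ih₂ (h₀.le.trans hj) hI ((hΓ.mono h₀.le).cond (ih hj hI hΓ h₀).2) h₁
  | bind _ _ ih₁ ih₂ =>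
    obtain ⟨a, f, k₁, k₂, h₁, h₂, h₃⟩ := hv.bind_inv
    have ha := (ih₁ hj hI hΓ h₁).1
    have hf := ih₂ (h₁.le.trans hj) hI (hΓ.mono h₁.le) h₂
    exact Ty.valid_weaken.1 (hf.2.2 _ le_rfl _ (ha.mono h₂.le) _ _ (by rwa [hI]))
  | down _ ih =>
    cases hv with
    | down h => exact ih hj hI hΓ h
  | sub _ hs ih => exact hs.valid hΓ.sat (ih hj hI hΓ hv)

theorem PolicyModule.MemTy.valid (hM : M.WellFormed) {I : Interp S} (h : M.MemTy I.mem) (k : ℕ)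
    (l : S.Loc) : (M.locTy l).Valid M k I (I.mem l) := by
  have key : ∀ k l (J : Interp S), J.mem = I.mem → (M.locTy l).Valid M k J (I.mem l) := by
    intro k
    induction k using Nat.strong_induction_on with
    | _ k ih =>
      intro l J hJ
      refine (h l).valid_of_store hM ih le_rfl hJ (.nil (hJ ▸ h.sorted hM)) (j := k) ?_
      rw [(h l).close_eq]
      exact .val _ _
  exact key k l I rfl

theorem HasTy.valid (hM : M.WellFormed) {Γ : TEnv S} {e : Expr S} {T : Ty S}
    (h : HasTy M Γ e T) {j j' : ℕ} {I : Interp S} (hI : M.MemTy I.mem) (hΓ : M.ValidEnv Γ j I)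
    {v : Val S} (hv : Ev M I.mem j (e.close I) v j') : T.Valid M j' I v :=
  h.valid_of_store hM (k := j)
    (fun j _ l J hJ => hJ ▸ PolicyModule.MemTy.valid hM (by rwa [hJ]) j l) le_rfl rfl hΓ hv

/-! ### Soundness for a run that is seen from another world -/

/-- Locations that `o` can see in `σ` have the same content in `τ`. -/
def PolicyModule.SeenIn {S : Sig.{u}} (M : PolicyModule S) (o : S.User) (σ τ : Mem S) : Prop :=
  ∀ l (I : Interp S), (M.locTy l).pol I σ o → σ l = τ l

theorem Ty.Cross.retarget {T : Ty S} {k m : ℕ} {I J : Interp S} {v c w : Val S}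
    (h : T.Cross M o k I J v c) (hw : T.Valid M m J w) (hvw : T.pol = Policy.top → w = v) :
    T.Cross M o k I J v w := by
  cases T with
  | fn => exact ⟨h.1, hw.hasSort, h.2.2⟩
  | sc B r =>
    refine ⟨?_, h.2.1, hw.2⟩
    cases B with
    | bool => exact ⟨hvw rfl, h.1.2⟩
    | str => exact ⟨hvw rfl, h.1.2⟩
    | user => exact ⟨hvw rfl, h.1.2⟩
    | ref => exact ⟨hvw rfl, h.1.2⟩
    | tag => exact ⟨hw.hasSort, h.1.2⟩

theorem Ty.pol_eq_of_at {T T' : Ty S} {π : Policy S} {r : Refn S} {I : Interp S}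
    (h : (Ty.sc (.tag T π) r).at I = T') (J : Interp S) : T'.pol J = π I := by
  subst h
  rfl

theorem HasTy.cross_of_store (hM : M.WellFormed) {σ τ : Mem S} (hσ : M.MemTy σ)
    (hτ : M.MemTy τ) (hE : M.SeenIn o σ τ) {k : ℕ}
    (hst : ∀ j < k, ∀ l (I J : Interp S), I.mem = σ → J.mem = τ →
      (M.locTy l).Cross M o j I J (σ l) (τ l))
    {Γ : TEnv S} {e : Expr S} {T : Ty S} (h : HasTy M Γ e T) {j j' : ℕ} (hj : j ≤ k)
    {I J : Interp S} (hI : I.mem = σ) (hJ : J.mem = τ) (hΓ : M.CrossEnv o Γ j I J) {v : Val S}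
    (hv : Ev M σ j (e.close I) v j') :
    ∃ w, T.Cross M o j' I J v w ∧ (∀ t, M.Reflects e t → w = t J) ∧
      (e.ConstHead → w = v) := by
  have hval : ∀ {Γ : TEnv S} {e : Expr S} {T : Ty S}, HasTy M Γ e T → ∀ {j j' : ℕ}
      {I : Interp S}, I.mem = σ → M.ValidEnv Γ j I → ∀ {v : Val S},
      Ev M σ j (e.close I) v j' → T.Valid M j' I v := by
    rintro Γ e T h j j' I rfl hΓ v hv
    exact h.valid hM hσ hΓ hv
  induction h generalizing j j' I J v with
  | const Γ c =>
    cases hv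
    refine ⟨.const c, hM.cross_const _ _ _ _ hΓ.valid.sat.sorted hΓ.sat.sorted, fun t ht => ?_,
      fun _ => rfl⟩
    cases ht
    rfl
  | @var Γ i T hl =>
    obtain ⟨rfl, rfl⟩ := Ev.of_val (v := I.env i) hv
    refine ⟨_, hΓ.lookup hl, fun t ht => ?_, nofun⟩
    cases ht
    rfl
  | @lam Γ e Tx T he ih =>
    have hvalid := hval (.lam he) hI hΓ.valid hv
    cases hv
    refine ⟨_, ⟨hvalid, hvalid.hasSort, fun i hi a b hab v i' he => ?_⟩, nofun, nofun⟩
    rw [hI] at he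
    obtain ⟨w, hw, _⟩ :=
      ih (hi.trans hj) (I := I.push a) (J := J.push b) hI hJ ((hΓ.mono hi).push hab) he.lam_app_inv
    exact ⟨w, hw, fun hc => absurd hc (Val.not_isConst_lam _)⟩
  | @app Γ e₁ e₂ Tx T t _ _ ht ih₁ ih₂ =>
    obtain ⟨f, a, k₁, k₂, h₁, h₂, h₃⟩ := hv.app_inv
    obtain ⟨g, hfg, hg, hg'⟩ := ih₁ hj hI hJ hΓ h₁
    obtain ⟨b, hab, hb, hb'⟩ := ih₂ (h₁.le.trans hj) hI hJ (hΓ.mono h₁.le) h₂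
    obtain ⟨w, hw, hw'⟩ := hfg.2.2 _ h₂.le _ _ hab _ _ (by rwa [hI])
    refine ⟨w, ?_, fun t' ht' => ?_, fun hc => ?_⟩
    · obtain rfl := ht.eval h₂
      obtain rfl := hb _ ht
      exact Ty.cross_subst.2 hw
    · have he := ht'.eval hv
      cases ht' with
      | app hc ht₁ ht₂ =>
        obtain rfl := hw' (hc.eval h₁)
        have hba := hab.eq_of_isPrim (hfg.1.2.1 (hc.eval h₁))
        beta_reduce
        rw [← hg _ ht₁, ← hb _ ht₂, hg' hc, hba, ht₁.eval h₁, ht₂.eval h₂]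
        exact he
    · cases hc with
      | app _ hc => exact hw' (hc.eval h₁)
  | @appConst Γ e₁ e₂ Tx T _ _ ih₁ ih₂ =>
    obtain ⟨f, a, k₁, k₂, h₁, h₂, h₃⟩ := hv.app_inv
    obtain ⟨g, hfg, hg, hg'⟩ := ih₁ hj hI hJ hΓ h₁
    obtain ⟨b, hab, hb, hb'⟩ := ih₂ (h₁.le.trans hj) hI hJ (hΓ.mono h₁.le) h₂
    obtain ⟨w, hw, hw'⟩ := hfg.2.2 _ h₂.le _ _ hab _ _ (by rwa [hI])
    refine ⟨w, Ty.cross_weaken.1 hw, fun t' ht' => ?_, fun hc => ?_⟩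
    · have he := ht'.eval hv
      cases ht' with
      | app hc ht₁ ht₂ =>
        obtain rfl := hw' (hc.eval h₁)
        have hba := hab.eq_of_isPrim (hfg.1.2.1 (hc.eval h₁))
        beta_reduce
        rw [← hg _ ht₁, ← hb _ ht₂, hg' hc, hba, ht₁.eval h₁, ht₂.eval h₂]
        exact he
    · cases hc with
      | app _ hc => exact hw' (hc.eval h₁)
  | @get Γ x B r t _ ht ih =>
    cases hv with
    | @get _ _ _ l h₁ =>
      obtain ⟨_, ⟨⟨rfl, _, hl, hT, hT'⟩, _⟩, ht', _⟩ := ih hj hI hJ hΓ h₁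
      obtain ⟨rfl⟩ := hl
      have hc := hM.loc_closed l
      have := (Ty.cross_congr (hT.trans (hc.at_eq I).symm) (hT'.trans (hc.at_eq J).symm) rfl
        _ _ _).2 (hst j' (h₁.le.trans hj) l I J hI hJ)
      exact ⟨τ l, ⟨this.1, ⟨this.2.1, l, (ht.eval h₁).symm, by rw [hI]⟩,
        this.2.2, l, (ht' _ ht).symm, by rw [hJ]⟩, nofun, nofun⟩
  | @getTag Γ x B r r' π t _ ht ih =>
    cases hv with
    | @get _ _ _ l h₁ =>
      obtain ⟨_, ⟨⟨rfl, _, hl, hT, hT'⟩, _⟩, ht', _⟩ := ih hj hI hJ hΓ h₁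
      obtain ⟨rfl⟩ := hl
      have hc := hM.loc_closed l
      have := (Ty.cross_congr (hT.trans (hc.at_eq I).symm) (hT'.trans (hc.at_eq J).symm) rfl
        _ _ _).2 (hst j' (h₁.le.trans hj) l I J hI hJ)
      have hw := (Ty.valid_congr (hT'.trans (hc.at_eq J).symm) rfl 0 _).2
        (PolicyModule.MemTy.valid hM (by rwa [hJ]) 0 l)
      rw [hJ] at hw
      have hs : ∃ l', t I = .const (.loc l') ∧ σ l = I.mem l' :=
        ⟨l, (ht.eval h₁).symm, by rw [hI]⟩
      have hs' : ∃ l', t J = .const (.loc l') ∧ τ l = J.mem l' :=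
        ⟨l, (ht' _ ht).symm, by rw [hJ]⟩
      refine ⟨τ l, ⟨⟨this.1.1, ⟨this.1.2.1.1, this.1.2.1.2, hs⟩, fun hπ => ?_⟩,
        ⟨this.2.1, hs⟩, this.2.2, hs'⟩, nofun, nofun⟩
      obtain ⟨c, hc⟩ := this.1.2.2 hπ
      have heq : σ l = τ l := hE l I (by rwa [Ty.pol_eq_of_at hT I, ← hI])
      have := hc.retarget hw.1 fun _ => heq.symm
      exact ⟨τ l, this.1, ⟨this.2.1, hs⟩, this.2.2, hs'⟩
  | ite _ _ _ ih ih₁ ih₂ =>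
    cases hv with
    | iteTrue h₀ h₁ =>
      obtain ⟨_, ⟨⟨rfl, _⟩, hr, hr'⟩, _⟩ := ih hj hI hJ hΓ h₀
      obtain ⟨w, hw, _⟩ :=
        ih₁ (h₀.le.trans hj) hI hJ ((hΓ.mono h₀.le).cond hr hr') h₁
      exact ⟨w, hw, nofun, nofun⟩
    | iteFalse h₀ h₁ =>
      obtain ⟨_, ⟨⟨rfl, _⟩, hr, hr'⟩, _⟩ := ih hj hI hJ hΓ h₀
      obtain ⟨w, hw, _⟩ :=
        ih₂ (h₀.le.trans hj) hI hJ ((hΓ.mono h₀.le).cond hr hr') h₁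
      exact ⟨w, hw, nofun, nofun⟩
  | bind he₁ he₂ ih₁ ih₂ =>
    have hvalid := (hval (.bind he₁ he₂) hI hΓ.valid hv).1
    obtain ⟨a, f, k₁, k₂, h₁, h₂, h₃⟩ := hv.bind_inv
    refine ⟨v, ⟨⟨Ty.Valid.hasSort hvalid, hvalid, fun hπ => ?_⟩, trivial, trivial⟩, nofun,
      nofun⟩
    obtain ⟨_, ha, _⟩ := ih₁ hj hI hJ hΓ h₁
    obtain ⟨b, hab⟩ := ha.1.2.2 hπ
    obtain ⟨g, hfg, _⟩ := ih₂ (h₁.le.trans hj) hI hJ (hΓ.mono h₁.le) h₂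
    obtain ⟨w, hw, _⟩ := hfg.2.2 _ le_rfl _ _ (hab.mono h₂.le) _ _ (by rwa [hI])
    exact (Ty.cross_weaken.1 hw).1.2.2 hπ
  | @down Γ e r π he ih =>
    have hvalid := (hval (.down he) hI hΓ.valid hv).1
    cases hv with
    | down h =>
      refine ⟨v, ⟨⟨Ty.Valid.hasSort hvalid, hvalid, fun hπ => ?_⟩, trivial, trivial⟩, nofun,
        nofun⟩
      obtain ⟨_, hw, _⟩ := ih hj hI hJ hΓ h
      by_cases hr : r I
      · exact hw.1.2.2 ⟨hπ, hr⟩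
      · exact ⟨v, ⟨rfl, hvalid.1⟩, hvalid.2, fun hb => absurd (hvalid.2 hb) hr⟩
  | sub _ hs ih =>
    obtain ⟨w, hw, h₁⟩ := ih hj hI hJ hΓ hv
    exact ⟨w, hs.cross hΓ.valid.sat hΓ.sat hw, h₁⟩

theorem PolicyModule.MemTy.cross (hM : M.WellFormed) {I J : Interp S} (hI : M.MemTy I.mem)
    (hJ : M.MemTy J.mem) (hE : M.SeenIn o I.mem J.mem) (k : ℕ) (l : S.Loc) :
    (M.locTy l).Cross M o k I J (I.mem l) (J.mem l) := by
  have key : ∀ k l (I' J' : Interp S), I'.mem = I.mem → J'.mem = J.mem →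
      (M.locTy l).Cross M o k I' J' (I.mem l) (J.mem l) := by
    intro k
    induction k using Nat.strong_induction_on with
    | _ k ih =>
      intro l I' J' hI' hJ'
      obtain ⟨c, hc, _⟩ := (hI l).cross_of_store hM hI hJ hE ih le_rfl hI' hJ'
        (.nil (hI' ▸ hI.sorted hM) (hJ' ▸ hJ.sorted hM)) (j := k) (j' := k) (v := I.mem l) (by
          rw [(hI l).close_eq]
          exact .val _ _)
      refine hc.retarget (m := 0) ?_ fun hp => (hE l I ?_).symm
      · have := PolicyModule.MemTy.valid hM (I := J') (by rwa [hJ']) 0 l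
        rwa [hJ'] at this
      · rw [hp]
        trivial
  exact key k l I J rfl rfl

theorem HasTy.cross (hM : M.WellFormed) {Γ : TEnv S} {e : Expr S} {T : Ty S}
    (h : HasTy M Γ e T) {j j' : ℕ} {I J : Interp S} (hI : M.MemTy I.mem) (hJ : M.MemTy J.mem)
    (hE : M.SeenIn o I.mem J.mem) (hΓ : M.CrossEnv o Γ j I J) {v : Val S}
    (hv : Ev M I.mem j (e.close I) v j') : ∃ w, T.Cross M o j' I J v w := by
  obtain ⟨w, hw, _⟩ := h.cross_of_store hM hI hJ hE (k := j) (fun j _ l I' J' hI' hJ' => by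
    have := PolicyModule.MemTy.cross (o := o) hM (I := I') (J := J') (by rwa [hI'])
      (by rwa [hJ']) (by rwa [hI', hJ']) j l
    rwa [hI', hJ'] at this) le_rfl rfl rfl hΓ hv
  exact ⟨w, hw⟩

/-! ### Agreement of two runs -/

theorem HasTy.agree_tag (hM : M.WellFormed) {Γ : TEnv S} {e : Expr S} {T : Ty S}
    {π : Policy S} {r : Refn S} (h : HasTy M Γ e (.sc (.tag T π) r)) {j j' m m' : ℕ}
    {I J : Interp S} (hI : M.MemTy I.mem) (hJ : M.MemTy J.mem) (hE : M.SeenIn o I.mem J.mem)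
    (hE' : M.SeenIn o J.mem I.mem) (hΓ : M.AgreeEnv o Γ j m I J) {v w : Val S}
    (hv : Ev M I.mem j (e.close I) v j') (hw : Ev M J.mem m (e.close J) w m')
    (hvw : π I I.mem o → π J J.mem o → T.Agree M o j' m' I J v w) :
    (Ty.sc (.tag T π) r).Agree M o j' m' I J v w := by
  have hv' := h.valid hM hI hΓ.cross.valid hv
  have hw' := h.valid hM hJ hΓ.cross_symm.valid hw
  obtain ⟨_, hc⟩ := h.cross hM hI hJ hE hΓ.cross hv
  obtain ⟨_, hc'⟩ := h.cross hM hJ hI hE' hΓ.cross_symm hw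
  exact ⟨⟨hv'.1, hw'.1, hc.1.2.2, hc'.1.2.2, hvw⟩, hv'.2, hw'.2⟩

theorem HasTy.agree_of_store (hM : M.WellFormed) {σ τ : Mem S} (hσ : M.MemTy σ)
    (hτ : M.MemTy τ) (hE : M.SeenIn o σ τ) (hE' : M.SeenIn o τ σ) {k : ℕ}
    (hst : ∀ j < k, ∀ m l (I J : Interp S), I.mem = σ → J.mem = τ →
      (M.locTy l).Agree M o j m I J (σ l) (τ l))
    {Γ : TEnv S} {e : Expr S} {T : Ty S} (h : HasTy M Γ e T) {j j' m m' : ℕ} (hj : j ≤ k)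
    {I J : Interp S} (hI : I.mem = σ) (hJ : J.mem = τ) (hΓ : M.AgreeEnv o Γ j m I J)
    {v w : Val S} (hv : Ev M σ j (e.close I) v j') (hw : Ev M τ m (e.close J) w m') :
    T.Agree M o j' m' I J v w := by
  have htag : ∀ {Γ : TEnv S} {e : Expr S} {T : Ty S} {π : Policy S} {r : Refn S},
      HasTy M Γ e (.sc (.tag T π) r) → ∀ {j j' m m' : ℕ} {I J : Interp S}, I.mem = σ →
      J.mem = τ → M.AgreeEnv o Γ j m I J → ∀ {v w : Val S}, Ev M σ j (e.close I) v j' →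
      Ev M τ m (e.close J) w m' →
      (π I I.mem o → π J J.mem o → T.Agree M o j' m' I J v w) →
      (Ty.sc (.tag T π) r).Agree M o j' m' I J v w := by
    rintro Γ e T π r h j j' m m' I J rfl rfl hΓ v w hv hw hvw
    exact h.agree_tag hM hσ hτ hE hE' hΓ hv hw hvw
  induction h generalizing j j' m m' I J v w with
  | const Γ c =>
    cases hv
    cases hw
    exact hM.agree_const _ _ _ _ _ hΓ.cross.valid.sat.sorted hΓ.cross.sat.sorted
  | @var Γ i T hl =>
    obtain ⟨rfl, rfl⟩ := Ev.of_val (v := I.env i) hv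
    obtain ⟨rfl, rfl⟩ := Ev.of_val (v := J.env i) hw
    exact hΓ.lookup hl
  | @lam Γ e Tx T he ih =>
    have hcr : (Ty.fn Tx T).Cross M o j' I J v w := by
      subst hI hJ
      obtain ⟨_, hc⟩ := (HasTy.lam he).cross hM hσ hτ hE hΓ.cross hv
      exact ⟨hc.1, ((HasTy.lam he).valid hM hτ hΓ.cross_symm.valid hw).1, hc.2.2⟩
    have hcr' : (Ty.fn Tx T).Cross M o m' J I w v := by
      subst hI hJ
      obtain ⟨_, hc⟩ := (HasTy.lam he).cross hM hτ hσ hE' hΓ.cross_symm hw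
      exact ⟨hc.1, ((HasTy.lam he).valid hM hσ hΓ.cross.valid hv).1, hc.2.2⟩
    cases hv
    cases hw
    refine ⟨hcr, hcr', fun i hi n hn a b hab v i' hv w n' hw => ?_⟩
    rw [hI] at hv
    rw [hJ] at hw
    exact ih (hi.trans hj) (I := I.push a) (J := J.push b) hI hJ ((hΓ.mono hi hn).push hab)
      hv.lam_app_inv hw.lam_app_inv
  | app _ _ ht ih₁ ih₂ =>
    obtain ⟨f, a, k₁, k₂, h₁, h₂, h₃⟩ := hv.app_inv
    obtain ⟨g, b, m₁, m₂, h₁', h₂', h₃'⟩ := hw.app_inv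
    have hf := ih₁ hj hI hJ hΓ h₁ h₁'
    have ha := ih₂ (h₁.le.trans hj) hI hJ (hΓ.mono h₁.le h₁'.le) h₂ h₂'
    obtain rfl := ht.eval h₂
    obtain rfl := ht.eval h₂'
    exact Ty.agree_subst.2 (hf.2.2 _ h₂.le _ h₂'.le _ _ ha _ _ (by rwa [hI]) _ _ (by rwa [hJ]))
  | appConst _ _ ih₁ ih₂ =>
    obtain ⟨f, a, k₁, k₂, h₁, h₂, h₃⟩ := hv.app_inv
    obtain ⟨g, b, m₁, m₂, h₁', h₂', h₃'⟩ := hw.app_inv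
    have hf := ih₁ hj hI hJ hΓ h₁ h₁'
    have ha := ih₂ (h₁.le.trans hj) hI hJ (hΓ.mono h₁.le h₁'.le) h₂ h₂'
    exact Ty.agree_weaken.1
      (hf.2.2 _ h₂.le _ h₂'.le _ _ ha _ _ (by rwa [hI]) _ _ (by rwa [hJ]))
  | @get Γ x B r t _ ht ih =>
    cases hv with
    | @get _ _ _ l h₁ =>
      cases hw with
      | @get _ _ _ l' h₁' =>
        obtain ⟨⟨heq, _, hl, hT, hT'⟩, _⟩ := ih hj hI hJ hΓ h₁ h₁'
        cases heq
        cases hl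
        have hc := hM.loc_closed l
        have := (Ty.agree_congr (hT.trans (hc.at_eq I).symm) (hT'.trans (hc.at_eq J).symm) rfl
          rfl _ _ _ _).2 (hst j' (h₁.le.trans hj) m' l I J hI hJ)
        exact ⟨this.1, ⟨this.2.1, l, (ht.eval h₁).symm, by rw [hI]⟩,
          this.2.2, l, (ht.eval h₁').symm, by rw [hJ]⟩
  | @getTag Γ x B r r' π t hx ht ih =>
    refine htag (.getTag hx ht) hI hJ hΓ hv hw fun hπ hπ' => ?_
    cases hv with
    | @get _ _ _ l h₁ =>
      cases hw with
      | @get _ _ _ l' h₁' =>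
        obtain ⟨⟨heq, _, hl, hT, hT'⟩, _⟩ := ih hj hI hJ hΓ h₁ h₁'
        cases heq
        cases hl
        have hc := hM.loc_closed l
        have := ((Ty.agree_congr (hT.trans (hc.at_eq I).symm) (hT'.trans (hc.at_eq J).symm) rfl
          rfl _ _ _ _).2 (hst j' (h₁.le.trans hj) m' l I J hI hJ)).1.2.2.2.2 hπ hπ'
        exact ⟨this.1, ⟨this.2.1, l, (ht.eval h₁).symm, by rw [hI]⟩,
          this.2.2, l, (ht.eval h₁').symm, by rw [hJ]⟩
  | ite _ _ _ ih ih₁ ih₂ =>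
    cases hv with
    | iteTrue h₀ h₁ =>
      cases hw with
      | iteTrue h₀' h₁' =>
        obtain ⟨_, hr, hr'⟩ := ih hj hI hJ hΓ h₀ h₀'
        exact ih₁ (h₀.le.trans hj) hI hJ ((hΓ.mono h₀.le h₀'.le).cond hr hr') h₁ h₁'
      | iteFalse h₀' h₁' => exact nomatch (ih hj hI hJ hΓ h₀ h₀').1.1
    | iteFalse h₀ h₁ =>
      cases hw with
      | iteTrue h₀' h₁' => exact nomatch (ih hj hI hJ hΓ h₀ h₀').1.1
      | iteFalse h₀' h₁' =>
        obtain ⟨_, hr, hr'⟩ := ih hj hI hJ hΓ h₀ h₀'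
        exact ih₂ (h₀.le.trans hj) hI hJ ((hΓ.mono h₀.le h₀'.le).cond hr hr') h₁ h₁'
  | bind he₁ he₂ ih₁ ih₂ =>
    refine htag (.bind he₁ he₂) hI hJ hΓ hv hw fun hπ hπ' => ?_
    obtain ⟨a, f, k₁, k₂, h₁, h₂, h₃⟩ := hv.bind_inv
    obtain ⟨b, g, m₁, m₂, h₁', h₂', h₃'⟩ := hw.bind_inv
    have ha := (ih₁ hj hI hJ hΓ h₁ h₁').1.2.2.2.2 hπ hπ'
    have hf := ih₂ (h₁.le.trans hj) hI hJ (hΓ.mono h₁.le h₁'.le) h₂ h₂'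
    exact (Ty.agree_weaken.1 (hf.2.2 _ le_rfl _ le_rfl _ _ (ha.mono h₂.le h₂'.le) _ _
      (by rwa [hI]) _ _ (by rwa [hJ]))).1.2.2.2.2 hπ hπ'
  | @down Γ e r π he ih =>
    refine htag (.down he) hI hJ hΓ hv hw fun hπ hπ' => ?_
    cases hv with
    | down h =>
      cases hw with
      | down h' =>
        obtain ⟨⟨⟨⟨b, hb⟩, hvr⟩, ⟨⟨b', hb'⟩, hwr⟩, hc, hc', hvw⟩, _⟩ := ih hj hI hJ hΓ h h'
        by_cases hr : r I
        · obtain ⟨c, hc⟩ := hc ⟨hπ, hr⟩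
          by_cases hr' : r J
          · exact hvw ⟨hπ, hr⟩ ⟨hπ', hr'⟩
          · obtain ⟨⟨rfl, _⟩, _, hcr⟩ := hc
            cases b with
            | true => exact absurd (hcr hb) hr'
            | false =>
              cases b' with
              | true => exact absurd (hwr hb') hr'
              | false => exact ⟨⟨hb'.trans hb.symm, _, hb⟩, hvr, hwr⟩
        · cases b with
          | true => exact absurd (hvr hb) hr
          | false =>
            cases b' with
            | true =>
              obtain ⟨c, ⟨rfl, _⟩, _, hcr⟩ := hc' ⟨hπ', hwr hb'⟩
              exact absurd (hcr hb') hr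
            | false => exact ⟨⟨hb'.trans hb.symm, _, hb⟩, hvr, hwr⟩
  | sub _ hs ih => exact hs.agree hΓ.cross.valid.sat hΓ.cross.sat (ih hj hI hJ hΓ hv hw)

theorem PolicyModule.MemTy.agree (hM : M.WellFormed) {I J : Interp S} (hI : M.MemTy I.mem)
    (hJ : M.MemTy J.mem) (hE : M.SeenIn o I.mem J.mem) (hE' : M.SeenIn o J.mem I.mem)
    (k m : ℕ) (l : S.Loc) : (M.locTy l).Agree M o k m I J (I.mem l) (J.mem l) := by
  have key : ∀ k m l (I' J' : Interp S), I'.mem = I.mem → J'.mem = J.mem →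
      (M.locTy l).Agree M o k m I' J' (I.mem l) (J.mem l) := by
    intro k
    induction k using Nat.strong_induction_on with
    | _ k ih =>
      intro m l I' J' hI' hJ'
      have heq : I.mem l = J.mem l →
          (M.locTy l).Agree M o k m I' J' (I.mem l) (J.mem l) := by
        intro heq
        refine (hI l).agree_of_store hM hI hJ hE hE' ih le_rfl hI' hJ'
          (.nil (hI' ▸ hI.sorted hM) (hJ' ▸ hJ.sorted hM)) (j := k) (m := m) ?_ ?_
        · rw [(hI l).close_eq]
          exact .val _ _
        · rw [(hI l).close_eq, heq]
          exact .val _ _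
      by_cases hp : (M.locTy l).pol = Policy.top
      · exact heq (hE l I (by rw [hp]; trivial))
      · have hv := PolicyModule.MemTy.valid hM (I := I') (by rwa [hI']) k l
        have hw := PolicyModule.MemTy.valid hM (I := J') (by rwa [hJ']) m l
        have hc := PolicyModule.MemTy.cross (o := o) hM (I := I') (J := J') (by rwa [hI'])
          (by rwa [hJ']) (by rwa [hI', hJ']) k l
        have hc' := PolicyModule.MemTy.cross (o := o) hM (I := J') (J := I') (by rwa [hJ'])
          (by rwa [hI']) (by rwa [hI', hJ']) m l
        have hvis := hE l I'
        rw [hI'] at hv hc hc'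
        rw [hJ'] at hw hc hc'
        generalize M.locTy l = T at *
        match T with
        | .sc (.tag T π) r =>
          exact ⟨⟨hv.1, hw.1, hc.1.2.2, hc'.1.2.2, fun hπ hπ' =>
            (heq (hvis (by rw [← hI']; exact hπ))).1.2.2.2.2 hπ hπ'⟩, hv.2, hw.2⟩
        | .sc .bool _ | .sc .str _ | .sc .user _ | .sc (.ref _) _ | .fn _ _ =>
          exact absurd rfl hp
  exact key k m l I J rfl rfl

theorem HasTy.agree (hM : M.WellFormed) {Γ : TEnv S} {e : Expr S} {T : Ty S}
    (h : HasTy M Γ e T) {j j' m m' : ℕ} {I J : Interp S} (hI : M.MemTy I.mem)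
    (hJ : M.MemTy J.mem) (hE : M.SeenIn o I.mem J.mem) (hE' : M.SeenIn o J.mem I.mem)
    (hΓ : M.AgreeEnv o Γ j m I J) {v w : Val S} (hv : Ev M I.mem j (e.close I) v j')
    (hw : Ev M J.mem m (e.close J) w m') : T.Agree M o j' m' I J v w :=
  h.agree_of_store hM hI hJ hE hE' (k := j) (fun j _ m l I' J' hI' hJ' => by
    have := PolicyModule.MemTy.agree (o := o) hM (I := I') (J := J') (by rwa [hI'])
      (by rwa [hJ']) (by rwa [hI', hJ']) (by rwa [hI', hJ']) j m l
    rwa [hI', hJ'] at this) le_rfl rfl rfl hΓ hv hw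

end Fundamental

/-! ### Print-programs -/

theorem Exec.print_inv {S : Sig.{u}} {M : PolicyModule S} {σ σ' : Store S} {x y : Expr S}
    (h : Exec M σ (.print x y) σ') :
    ∃ a v, x = (Val.const (.user a)).toExpr ∧ y = v.toExpr ∧ σ' = σ.emit a v := by
  generalize hs : Stmt.print x y = s at h
  cases h with
  | print a v =>
    injection hs with hx hy
    exact ⟨a, v, hx, hy, rfl⟩
  | letIn => cases hs
  | set => cases hs

theorem StmtTy.exec_agree {S : Sig.{u}} {M : PolicyModule S} {o : S.User} (hM : M.WellFormed)
    {Γ : TEnv S} {s : Stmt S} (hs : StmtTy M Γ s) (hp : s.IsPrintProgram)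
    {σ τ σ' τ' : Store S} (hσ : M.MemTy σ.mem) (hτ : M.MemTy τ.mem)
    (hE : M.SeenIn o σ.mem τ.mem) (hE' : M.SeenIn o τ.mem σ.mem) (hout : σ.out o = τ.out o)
    {I J : Interp S} (hI : I.mem = σ.mem) (hJ : J.mem = τ.mem)
    (hΓ : ∀ k m, M.AgreeEnv o Γ k m I J) {ρ ρ' : ℕ → Expr S}
    (hρ : ∀ i, Std M σ.mem (I.env i).toExpr (ρ i))
    (hρ' : ∀ i, Std M τ.mem (J.env i).toExpr (ρ' i))
    (hx : Exec M σ (s.subst ρ) σ') (hx' : Exec M τ (s.subst ρ') τ') :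
    σ'.mem = σ.mem ∧ τ'.mem = τ.mem ∧ σ'.out o = τ'.out o := by
  induction hs generalizing I J ρ ρ' with
  | @letIn Γ e s T he _ ih =>
    cases hp with
    | letIn _ hp =>
    cases hx with
    | letIn h₁ h₂ =>
    cases hx' with
    | letIn h₁' h₂' =>
    obtain ⟨v₀, hv, hv'⟩ := Std.ev (((Std.refl e).subst hσ.noFree hρ).steps hσ.noFree h₁)
    obtain ⟨w₀, hw, hw'⟩ := Std.ev (((Std.refl e).subst hτ.noFree hρ').steps hτ.noFree h₁')
    rw [Stmt.inst, Stmt.subst_liftSub_single] at h₂ h₂'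
    refine ih hp (I := I.push v₀) (J := J.push w₀) hI hJ (fun k m => ?_) ?_ ?_ h₂ h₂'
    · obtain ⟨j, hj⟩ := hv k
      obtain ⟨i, hi⟩ := hw m
      rw [← hI] at hσ hE hE' hj
      rw [← hJ] at hτ hE hE' hi
      exact (hΓ k m).push (he.agree hM hσ hτ hE hE' (hΓ j i) hj hi)
    · intro i
      cases i with
      | zero => exact hv'
      | succ i => exact hρ i
    · intro i
      cases i with
      | zero => exact hw'
      | succ i => exact hρ' i
  | @print Γ x y π hxt hyt =>
    obtain ⟨a, u, hxa, hyu, rfl⟩ := hx.print_inv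
    obtain ⟨b, w, hxb, hyw, rfl⟩ := hx'.print_inv
    refine ⟨rfl, rfl, ?_⟩
    have sound : ∀ {e : Expr S} {T : Ty S} {v w : Val S}, HasTy M Γ e (T.tagged π) →
        e.subst ρ = v.toExpr → e.subst ρ' = w.toExpr → ∃ v₀ w₀,
          (T.tagged π).Agree M o 0 0 I J v₀ w₀ ∧ Std M σ.mem v₀.toExpr v.toExpr ∧
            Std M τ.mem w₀.toExpr w.toExpr := by
      intro e T v w he hv hw
      obtain ⟨v₀, hv₀, hv⟩ := Std.ev (hv ▸ (Std.refl e).subst hσ.noFree hρ)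
      obtain ⟨w₀, hw₀, hw⟩ := Std.ev (hw ▸ (Std.refl e).subst hτ.noFree hρ')
      obtain ⟨j, hj⟩ := hv₀ 0
      obtain ⟨i, hi⟩ := hw₀ 0
      refine ⟨v₀, w₀, ?_, hv, hw⟩
      rw [← hI] at hσ hE hE' hj
      rw [← hJ] at hτ hE hE' hi
      exact he.agree hM hσ hτ hE hE' (hΓ j i) hj hi
    obtain ⟨a₀, b₀, ⟨⟨⟨⟨a', rfl⟩, a'', haa, hπa⟩, ⟨⟨b', rfl⟩, b'', hbb, hπb⟩, hab, hba, hxx⟩, _⟩,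
      ha, hb⟩ := sound (v := .const (.user a)) (w := .const (.user b)) hxt hxa hxb
    cases haa
    cases hbb
    cases ha.const_eq
    cases hb.const_eq
    obtain ⟨u₀, w₀, ⟨⟨⟨⟨u', rfl⟩, _⟩, ⟨⟨w', rfl⟩, _⟩, _, _, hyy⟩, _⟩, hu, hw⟩ :=
      sound hyt hyu hyw
    obtain rfl : u = .const (.str u') := Val.toExpr_injective hu.const_eq
    obtain rfl : w = .const (.str w') := Val.toExpr_injective hw.const_eq
    have hvis : a = o ∨ b = o → π I I.mem o ∧ π J J.mem o := by
      rintro (rfl | rfl)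
      · obtain ⟨_, ⟨rfl, _⟩, _, _, hc, hπ⟩ := hab hπa
        cases hc
        exact ⟨hπa, hπ⟩
      · obtain ⟨_, ⟨rfl, _⟩, _, _, hc, hπ⟩ := hba hπb
        cases hc
        exact ⟨hπ, hπb⟩
    by_cases h : a = o ∨ b = o
    · obtain ⟨hπ, hπ'⟩ := hvis h
      have hxe := (hxx hπ hπ').1.1
      have hye := (hyy hπ hπ').1.1
      cases hxe
      cases hye
      obtain rfl : a = o := h.elim id id
      simp [Store.emit, hout]
    · rw [not_or] at h
      have hne : ∀ (σ : Store S) (c : S.User) (v : Val S), c ≠ o →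
          (σ.emit c v).out o = σ.out o := by
        intro σ c v hc
        simp [Store.emit, Function.update, hc.symm]
      rw [hne _ _ _ h.1, hne _ _ _ h.2, hout]
  | set => cases hp

theorem Ty.Closed.pol_congr {S : Sig.{u}} {T : Ty S} (h : T.Closed) (I J : Interp S) :
    T.pol I = T.pol J := by
  rw [← h fun _ => I]
  cases T with
  | sc B r => cases B <;> rfl
  | fn => rfl

theorem mainTheorem3 {S : Sig.{u}} (M : PolicyModule S) (hM : M.WellFormed)
    (o : S.User) (σ₁ σ₂ : Store S) (h₁ : M.StoreTy σ₁) (h₂ : M.StoreTy σ₂)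
    (hσ : M.ObsEquiv o σ₁ σ₂)
    (s : Stmt S) (hprint : s.IsPrintProgram) (hs : StmtTy M [] s)
    (σ₁' σ₂' : Store S) (hx₁ : Exec M σ₁ s σ₁') (hx₂ : Exec M σ₂ s σ₂') :
    M.ObsEquiv o σ₁' σ₂' := by
  have hseen : ∀ {σ τ : Store S}, M.ObsEquiv o σ τ → M.SeenIn o σ.mem τ.mem := by
    intro σ τ h l I hl
    refine h.2 l (.inl ?_)
    rwa [PolicyModule.Visible, (hM.loc_closed l).pol_congr _ I]
  have hsymm : M.ObsEquiv o σ₂ σ₁ := ⟨hσ.1.symm, fun l hl => (hσ.2 l hl.symm).symm⟩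
  let I : Mem S → Interp S := fun σ => ⟨σ, fun _ => .const (.bool true)⟩
  have hself : s.subst (fun _ => .const (.bool true)) = s := hs.subst_eq_self _ nofun
  rw [← hself] at hx₁ hx₂
  obtain ⟨hm₁, hm₂, hout⟩ := hs.exec_agree hM hprint h₁ h₂ (hseen hσ) (hseen hsymm) hσ.1
    (I := I σ₁.mem) (J := I σ₂.mem) rfl rfl
    (fun _ _ => .nil (PolicyModule.MemTy.sorted hM h₁) (PolicyModule.MemTy.sorted hM h₂))
    (fun _ => .const _) (fun _ => .const _) hx₁ hx₂
  refine ⟨hout, fun l hl => ?_⟩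
  rw [hm₁, hm₂]
  refine hσ.2 l ?_
  simpa only [PolicyModule.obs, Set.mem_ofPred_eq, hm₁, hm₂] using hl
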